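/- Let $\Bbbk$ be a field, $H$ a finite-dimensional semisimple Hopf algebra over $\Bbbk$, and $R=\bigoplus_{n\ge 0}R_n$ a (left and right) noetherian $\mathbb N$-graded $\Bbbk$-algebra that is locally finite (each $R_n$ is finite-dimensional). Let $R$ be a left $H$-module algebra on which $H$ acts homogeneously ($H\cdot R_n\subseteq R_n$ for all $n$), and let $B:=R\#H$ be the smash product, i.e. $R\otimes H$ with $(r\#h)(s\#g)=\sum r(h_{1}\cdot s)\#h_{2}g$, graded by $B_n=R_n\otimes H$. Identify $R$ with the subalgebra $R\# 1$ of $B$. Graded modules are $\mathbb Z$-graded right modules. For a right module $M$ over $A\in\{R,B\}$ let $j(M_A)=\min\{i\mid \operatorname{Ext}^i_A(M,A)\neq 0\}$ be its grade ($\infty$ if there is no such $i$). Let $\partial$ be an exact dimension function on finitely generated graded right $R$-modules and on finitely generated graded right $B$-modules: it takes values in $\mathbb R\cup\{\pm\infty\}$, is invariant under isomorphism of graded modules, and satisfies $\partial(M)=\max\{\partial(N),\partial(M/N)\}$ for every graded submodule $N$ of $M$. Assume that $\partial$ is $B/R$-hereditary: $\partial(M_R)=\partial(M_B)$ for every finitely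 generated graded right $B$-module $M$. For $A\in\{R,B\}$ and an integer $s$, suppose $\partial(A)=d\in\mathbb N$. Then $A$ is called (graded) - $\partial$-CM if $j(M)+\partial(M)=d$ for every nonzero finitely generated graded right $A$-module $M$; - $\partial$-CM$(s)$ if $\partial(M)\le d-s\Leftrightarrow j(M)\ge s$ for every finitely generated graded right $A$-module $M$; - $\partial$-CM$^l(s)$ if $\partial(M)\le d-s\Rightarrow j(M)\ge s$ for every such $M$; - $\partial$-CM$^r(s)$ if $j(M)\ge s\Rightarrow \partial(M)\le d-s$ for every such $M$. Then $B$ is left and right noetherian, $j(M_B)=j(M_R)$ for every finitely generated graded right $B$-module $M$, and if $R$ is $\partial$-CM (respectively $\partial$-CM$(s)$, $\partial$-CM$^l(s)$, $\partial$-CM$^r(s)$), then so is $B=R\#H$. -/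

import Mathlib

open CategoryTheory TensorProduct

universe u

/-! ## Module algebras over a Hopf algebra and smash products -/

section SmashProduct

variable (k H R : Type u) [Field k] [Ring H] [HopfAlgebra k H] [Ring R] [Algebra k R]
  [Module H R]

/-- `R` is a (left) `H`-module algebra: `h ⬝ 1 = ε(h) 1` and
`h ⬝ (a b) = ∑ (h₁ ⬝ a) (h₂ ⬝ b)`, where `Δ(h) = ∑ h₁ ⊗ h₂`.  The `H`-action extends the scalar
action of `k`. -/
class HopfModuleAlgebra : Prop extends IsScalarTower k H R where
  hopf_smul_one : ∀ h : H, h • (1 : R) = algebraMap k R (Coalgebra.counit h)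
  hopf_smul_mul : ∀ (h : H) (a b : R), h • (a * b) =
    LinearMap.mul' k R (TensorProduct.map
      ((LinearMap.toSpanSingleton H R a).restrictScalars k)
      ((LinearMap.toSpanSingleton H R b).restrictScalars k) (Coalgebra.comul h))

/-- The underlying space `R ⊗ H` of the smash product `R # H`. -/
def SmashProduct : Type u := R ⊗[k] H

namespace SmashProduct

noncomputable instance : AddCommGroup (SmashProduct k H R) :=
  inferInstanceAs (AddCommGroup (R ⊗[k] H))

noncomputable instance : Module k (SmashProduct k H R) :=
  inferInstanceAs (Module k (R ⊗[k] H))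

/-- The element `r # h`. -/
noncomputable def mk (r : R) (h : H) : SmashProduct k H R := (r ⊗ₜ[k] h : R ⊗[k] H)

/-- Left multiplication `r ⬝ (s ⊗ g) = r s ⊗ g` of `R` on `R ⊗ H`. -/
noncomputable def left : R →ₐ[k] Module.End k (R ⊗[k] H) :=
  (Module.endTensorEndAlgHom (R := k) (S := k) (A := k) (M := R) (N := H)).comp
    (Algebra.TensorProduct.includeLeft.comp (Algebra.lmul k R))

variable {k H R} in
theorem left_tmul (r s : R) (g : H) : left k H R r (s ⊗ₜ g) = (r * s) ⊗ₜ g := by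
  change Module.endTensorEndAlgHom (R := k) (S := k) (A := k) (M := R) (N := H)
    (Algebra.lmul k R r ⊗ₜ 1) (s ⊗ₜ g) = _
  rw [Module.endTensorEndAlgHom_apply]
  rfl

variable [HopfModuleAlgebra k H R]

/-- The diagonal action `h ⬝ (s ⊗ g) = ∑ (h₁ ⬝ s) ⊗ h₂ g` of `H` on `R ⊗ H`. -/
noncomputable def diag : H →ₐ[k] Module.End k (R ⊗[k] H) :=
  ((Module.endTensorEndAlgHom (R := k) (S := k) (A := k) (M := R) (N := H)).comp
    (Algebra.TensorProduct.map (Algebra.lsmul k k R) (Algebra.lmul k H))).comp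
    (Bialgebra.comulAlgHom k H)

/-- Left multiplication in `R # H`: the element `r # h` acts by
`s # g ↦ ∑ r (h₁ ⬝ s) # h₂ g`. -/
noncomputable def mulLeft : R ⊗[k] H →ₗ[k] Module.End k (R ⊗[k] H) :=
  TensorProduct.lift
    ((LinearMap.mul k (Module.End k (R ⊗[k] H))).compl₁₂
      (left k H R).toLinearMap (diag k H R).toLinearMap)

variable {k H R}

theorem mulLeft_tmul (r : R) (h : H) :
    mulLeft k H R (r ⊗ₜ h) = left k H R r * diag k H R h := rfl

/-- `h ⬝ (s ⊗ g) = ∑ (h₁ ⬝ s) ⊗ h₂ g`. -/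
theorem diag_tmul (h : H) (s : R) (g : H) :
    diag k H R h (s ⊗ₜ g) = TensorProduct.map
      ((LinearMap.toSpanSingleton H R s).restrictScalars k)
      (LinearMap.mulRight k g) (Coalgebra.comul h) := by
  change (Module.endTensorEndAlgHom (R := k) (S := k) (A := k) (M := R) (N := H)
    (Algebra.TensorProduct.map (Algebra.lsmul k k R) (Algebra.lmul k H)
      (Coalgebra.comul h))) (s ⊗ₜ g) = _
  induction (Coalgebra.comul h : H ⊗[k] H) using TensorProduct.induction_on with
  | zero => simp
  | tmul x y =>
    rw [Algebra.TensorProduct.map_tmul, Module.endTensorEndAlgHom_apply]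
    rfl
  | add x y hx hy => simp only [map_add, LinearMap.add_apply, hx, hy]

/-- The commutation rule `h r = ∑ (h₁ ⬝ r) h₂`. -/
theorem diag_mul_left (h : H) (s : R) :
    diag k H R h * left k H R s = mulLeft k H R (diag k H R h (s ⊗ₜ 1)) := by
  refine LinearMap.ext fun x => ?_
  induction x using TensorProduct.induction_on with
  | zero => simp
  | add x y hx hy => rw [map_add, map_add, hx, hy]
  | tmul t g =>
    let a : R → H →ₗ[k] R := fun s => (LinearMap.toSpanSingleton H R s).restrictScalars k
    let F : H ⊗[k] (H ⊗[k] H) →ₗ[k] R ⊗[k] H :=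
      TensorProduct.map (LinearMap.mul' k R) LinearMap.id ∘ₗ
        (TensorProduct.assoc k R R H).symm.toLinearMap ∘ₗ
        TensorProduct.map (a s) (TensorProduct.map (a t) (LinearMap.mulRight k g))
    have h1 : diag k H R h (left k H R s (t ⊗ₜ g)) =
        F (TensorProduct.assoc k H H H (Coalgebra.comul.rTensor H (Coalgebra.comul h))) := by
      rw [left_tmul, diag_tmul]
      induction (Coalgebra.comul h : H ⊗[k] H) using TensorProduct.induction_on with
      | zero => simp
      | add x y hx hy => simp only [map_add, hx, hy]
      | tmul x y =>
        have : (LinearMap.toSpanSingleton H R (s * t)).restrictScalars k x =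
            LinearMap.mul' k R (TensorProduct.map (a s) (a t) (Coalgebra.comul x)) :=
          HopfModuleAlgebra.hopf_smul_mul x s t
        rw [TensorProduct.map_tmul, this, LinearMap.rTensor_tmul]
        induction (Coalgebra.comul x : H ⊗[k] H) using TensorProduct.induction_on with
        | zero => simp
        | add x y hx hy => simp only [map_add, TensorProduct.add_tmul, hx, hy]
        | tmul x z => simp [F, a]
    have h2 : mulLeft k H R (diag k H R h (s ⊗ₜ 1)) (t ⊗ₜ g) =
        F (Coalgebra.comul.lTensor H (Coalgebra.comul h)) := by
      rw [diag_tmul]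
      induction (Coalgebra.comul h : H ⊗[k] H) using TensorProduct.induction_on with
      | zero => simp
      | add x y hx hy => simp only [map_add, LinearMap.add_apply, hx, hy]
      | tmul x y =>
        rw [TensorProduct.map_tmul, mulLeft_tmul, Module.End.mul_apply, LinearMap.lTensor_tmul]
        simp only [LinearMap.mulRight_apply, mul_one]
        rw [diag_tmul]
        induction (Coalgebra.comul y : H ⊗[k] H) using TensorProduct.induction_on with
        | zero => simp
        | add x y hx hy => simp only [map_add, TensorProduct.tmul_add, hx, hy]
        | tmul y z => simp [F, a, left_tmul]
    rw [Module.End.mul_apply, h1, h2, Coalgebra.coassoc_apply]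

theorem mulLeft_left (r : R) (x : R ⊗[k] H) :
    mulLeft k H R (left k H R r x) = left k H R r * mulLeft k H R x := by
  induction x using TensorProduct.induction_on with
  | zero => simp
  | add x y hx hy => simp only [map_add, mul_add, hx, hy]
  | tmul s g => rw [left_tmul, mulLeft_tmul, mulLeft_tmul, map_mul, mul_assoc]

theorem mulLeft_diag (h : H) (x : R ⊗[k] H) :
    mulLeft k H R (diag k H R h x) = diag k H R h * mulLeft k H R x := by
  induction x using TensorProduct.induction_on with
  | zero => simp
  | add x y hx hy => simp only [map_add, mul_add, hx, hy]
  | tmul s g =>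
    rw [mulLeft_tmul, ← mul_assoc, diag_mul_left, diag_tmul, diag_tmul]
    induction (Coalgebra.comul h : H ⊗[k] H) using TensorProduct.induction_on with
    | zero => simp
    | add x y hx hy => simp only [map_add, add_mul, hx, hy]
    | tmul x y => simp [mulLeft_tmul, mul_assoc]

theorem mulLeft_mulLeft (x y : R ⊗[k] H) :
    mulLeft k H R (mulLeft k H R x y) = mulLeft k H R x * mulLeft k H R y := by
  induction x using TensorProduct.induction_on with
  | zero => simp
  | add x z hx hz => simp only [map_add, add_mul, LinearMap.add_apply, hx, hz]
  | tmul r h =>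
    rw [mulLeft_tmul, Module.End.mul_apply, mulLeft_left, mulLeft_diag, mul_assoc]

theorem mulLeft_one_tmul_one : mulLeft k H R (1 ⊗ₜ 1) = 1 := by
  rw [mulLeft_tmul, map_one, map_one, one_mul]

theorem mulLeft_apply_one (x : R ⊗[k] H) : mulLeft k H R x (1 ⊗ₜ 1) = x := by
  induction x using TensorProduct.induction_on with
  | zero => simp
  | add x y hx hy => simp only [map_add, LinearMap.add_apply, hx, hy]
  | tmul r h =>
    rw [mulLeft_tmul, Module.End.mul_apply, diag_tmul]
    have : ∀ z : H ⊗[k] H, TensorProduct.map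
        ((LinearMap.toSpanSingleton H R (1 : R)).restrictScalars k) (LinearMap.mulRight k 1) z =
        TensorProduct.map (Algebra.linearMap k R) LinearMap.id
          (Coalgebra.counit.rTensor H z) := by
      intro z
      induction z using TensorProduct.induction_on with
      | zero => simp
      | add x y hx hy => simp only [map_add, hx, hy]
      | tmul x y => simp [HopfModuleAlgebra.hopf_smul_one (k := k) x]
    rw [this, Coalgebra.rTensor_counit_comul]
    simp [left_tmul]

variable (k H R)

/-- The smash product `R # H`, with `(r # h) (s # g) = ∑ r (h₁ ⬝ s) # h₂ g` and unit `1 # 1`. -/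
noncomputable instance : Ring (SmashProduct k H R) where
  mul x y := mulLeft k H R x y
  one := ((1 : R) ⊗ₜ[k] (1 : H) : R ⊗[k] H)
  left_distrib x y z := map_add (mulLeft k H R x) y z
  right_distrib x y z := LinearMap.congr_fun (map_add (mulLeft k H R) x y) z
  zero_mul x := LinearMap.congr_fun (map_zero (mulLeft k H R)) x
  mul_zero x := map_zero (mulLeft k H R x)
  mul_assoc x y z := LinearMap.congr_fun (mulLeft_mulLeft x y) z
  one_mul x := LinearMap.congr_fun (mulLeft_one_tmul_one (k := k) (H := H) (R := R)) x
  mul_one x := mulLeft_apply_one x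
  neg_add_cancel := neg_add_cancel
  zsmul := fun n x => n • x
  zsmul_zero' := SubNegMonoid.zsmul_zero'
  zsmul_succ' := SubNegMonoid.zsmul_succ'
  zsmul_neg' := SubNegMonoid.zsmul_neg'
  sub_eq_add_neg := sub_eq_add_neg

noncomputable instance : Algebra k (SmashProduct k H R) :=
  Algebra.ofModule
    (fun c x y => LinearMap.congr_fun (map_smul (mulLeft k H R) c x) y)
    (fun c x y => map_smul (mulLeft k H R x) c y)

variable {k H R}

theorem mk_mul_mk (r s : R) (h g : H) :
    mk k H R r h * mk k H R s g =
      (TensorProduct.map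
        (LinearMap.mulLeft k r ∘ₗ (LinearMap.toSpanSingleton H R s).restrictScalars k)
        (LinearMap.mulRight k g) (Coalgebra.comul h) : R ⊗[k] H) := by
  change left k H R r (diag k H R h (s ⊗ₜ g)) = _
  rw [diag_tmul]
  induction (Coalgebra.comul h : H ⊗[k] H) using TensorProduct.induction_on with
  | zero => simp
  | add x y hx hy => rw [map_add, map_add, map_add, hx, hy]
  | tmul x y => simp [left_tmul]

theorem mk_mul_mk_one (r s : R) (g : H) :
    mk k H R r 1 * mk k H R s g = mk k H R (r * s) g := by
  change mulLeft k H R (r ⊗ₜ 1) (s ⊗ₜ g) = _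
  rw [mulLeft_tmul, map_one, mul_one, left_tmul]
  rfl

variable (k H R)

/-- The inclusion `R → R # H`, `r ↦ r # 1`. -/
noncomputable def incl : R →ₐ[k] SmashProduct k H R :=
  AlgHom.ofLinearMap ((TensorProduct.mk k R H).flip 1 : R →ₗ[k] R ⊗[k] H) rfl
    (fun r s => (mk_mul_mk_one r s 1).symm)

end SmashProduct

end SmashProduct

/-! ## The grading on the smash product -/

section Grading

variable {k R : Type u} (H : Type u) [Field k] [Ring H] [HopfAlgebra k H] [Ring R] [Algebra k R]

/-- `H` acts homogeneously: every homogeneous component of `R` is stable under `H`. -/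
class ActsHomogeneously [Module H R] (𝓡 : ℕ → Submodule k R) : Prop where
  smul_mem : ∀ (h : H) (n : ℕ) (r : R), r ∈ 𝓡 n → h • r ∈ 𝓡 n

/-- The degree `n` component `𝓡 n ⊗ H` of `R ⊗ H`, where `H` sits in degree `0`. -/
noncomputable def tensorGrading (𝓡 : ℕ → Submodule k R) (n : ℕ) : Submodule k (R ⊗[k] H) :=
  LinearMap.range ((𝓡 n).subtype.rTensor H)

/-- The grading of `R # H`, with degree `n` component `𝓡 n # H`. -/
noncomputable def smashGrading (𝓡 : ℕ → Submodule k R) (n : ℕ) :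
    Submodule k (SmashProduct k H R) :=
  (tensorGrading H 𝓡 n : Submodule k (R ⊗[k] H))

namespace smashGrading

variable {H} (𝓡 : ℕ → Submodule k R)

theorem tmul_mem {n : ℕ} {r : R} (hr : r ∈ 𝓡 n) (h : H) :
    (r ⊗ₜ[k] h : R ⊗[k] H) ∈ tensorGrading H 𝓡 n :=
  ⟨(⟨r, hr⟩ : 𝓡 n) ⊗ₜ h, rfl⟩

theorem mulLeft_mem [Module H R] [HopfModuleAlgebra k H R] [GradedAlgebra 𝓡]
    [ActsHomogeneously H 𝓡] {i j : ℕ} {x y : R ⊗[k] H} (hx : x ∈ tensorGrading H 𝓡 i) (hy : y ∈ tensorGrading H 𝓡 j) :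
    SmashProduct.mulLeft k H R x y ∈ tensorGrading H 𝓡 (i + j) := by
  obtain ⟨x, rfl⟩ := hx
  obtain ⟨y, rfl⟩ := hy
  induction x using TensorProduct.induction_on with
  | zero => simp
  | add a b ha hb => rw [map_add, map_add, LinearMap.add_apply]; exact Submodule.add_mem _ ha hb
  | tmul r h =>
    induction y using TensorProduct.induction_on with
    | zero => simp
    | add a b ha hb => rw [map_add, map_add]; exact Submodule.add_mem _ ha hb
    | tmul s g =>
      simp only [LinearMap.rTensor_tmul, Submodule.subtype_apply, SmashProduct.mulLeft_tmul,
        Module.End.mul_apply, SmashProduct.diag_tmul]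
      induction (Coalgebra.comul h : H ⊗[k] H) using TensorProduct.induction_on with
      | zero => simp
      | add x y hx hy => rw [map_add, map_add]; exact Submodule.add_mem _ hx hy
      | tmul a b =>
        rw [TensorProduct.map_tmul, SmashProduct.left_tmul]
        exact tmul_mem 𝓡 (SetLike.GradedMul.mul_mem r.2
          (ActsHomogeneously.smul_mem a j s.1 s.2)) (b * g)

/-- The decomposition of `r ⊗ h` into the elements `rₙ ⊗ h`. -/
noncomputable def decomposeMap [GradedAlgebra 𝓡] :
    R ⊗[k] H →ₗ[k] DirectSum ℕ (fun n => tensorGrading H 𝓡 n) :=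
  TensorProduct.lift
    ((DirectSum.toModule k ℕ (H →ₗ[k] DirectSum ℕ (fun n => tensorGrading H 𝓡 n)) fun n =>
      (TensorProduct.mk k (𝓡 n) H).compr₂
        (DirectSum.lof k ℕ (fun n => tensorGrading H 𝓡 n) n ∘ₗ
          LinearMap.rangeRestrict ((𝓡 n).subtype.rTensor H))) ∘ₗ
      (DirectSum.decomposeLinearEquiv 𝓡).toLinearMap)

theorem decomposeMap_tmul [GradedAlgebra 𝓡] {n : ℕ} (r : 𝓡 n) (h : H) :
    decomposeMap 𝓡 ((r : R) ⊗ₜ h) =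
      DirectSum.lof k ℕ (fun n => tensorGrading H 𝓡 n) n
        (LinearMap.rangeRestrict ((𝓡 n).subtype.rTensor H) (r ⊗ₜ h)) := by
  simp only [decomposeMap, TensorProduct.lift.tmul, LinearMap.comp_apply, LinearEquiv.coe_coe,
    DirectSum.decomposeLinearEquiv_apply]
  rw [DirectSum.decompose_coe 𝓡 r]
  erw [DirectSum.toModule_lof]
  rfl

noncomputable instance tensorDecomposition [GradedAlgebra 𝓡] :
    DirectSum.Decomposition (tensorGrading H 𝓡) := by
  refine DirectSum.Decomposition.ofLinearMap (tensorGrading H 𝓡) (decomposeMap 𝓡) ?_ ?_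
  · refine TensorProduct.ext' fun r h => ?_
    induction r using DirectSum.Decomposition.inductionOn 𝓡 with
    | zero => simp
    | add r s hr hs => rw [TensorProduct.add_tmul, map_add, map_add, hr, hs]
    | homogeneous r =>
      rw [LinearMap.comp_apply, decomposeMap_tmul 𝓡 r]
      change DirectSum.coeLinearMap (tensorGrading H 𝓡)
        (DirectSum.lof k ℕ (fun n => tensorGrading H 𝓡 n) _ ⟨_, tmul_mem 𝓡 r.2 h⟩) = _
      rw [DirectSum.coeLinearMap_lof]
      rfl
  · refine DirectSum.linearMap_ext _ fun n => LinearMap.ext fun x => ?_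
    obtain ⟨_, y, rfl⟩ := x
    have key : decomposeMap 𝓡 ∘ₗ (𝓡 n).subtype.rTensor H =
        DirectSum.lof k ℕ (fun n => tensorGrading H 𝓡 n) n ∘ₗ
          LinearMap.rangeRestrict ((𝓡 n).subtype.rTensor H) :=
      TensorProduct.ext' fun r h => decomposeMap_tmul 𝓡 r h
    rw [LinearMap.comp_apply, LinearMap.comp_apply, DirectSum.coeLinearMap_lof]
    exact LinearMap.congr_fun key y

noncomputable instance [Module H R] [HopfModuleAlgebra k H R] [GradedAlgebra 𝓡]
    [ActsHomogeneously H 𝓡] :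
    GradedAlgebra (smashGrading H 𝓡) where
  one_mem := tmul_mem 𝓡 (SetLike.GradedOne.one_mem) 1
  mul_mem _ _ _ _ hx hy := mulLeft_mem 𝓡 hx hy
  toDecomposition := tensorDecomposition 𝓡

end smashGrading

end Grading

/-! ## Graded right modules -/

section GradedModules

variable {k A : Type u} [Field k] [Ring A] [Algebra k A] (𝓐 : ℕ → Submodule k A)

/-- A `ℤ`-graded right module over the `ℕ`-graded algebra `A`.  Right `A`-modules are modules
over the opposite ring `Aᵐᵒᵖ`: `m a` is written `MulOpposite.op a • m`. -/
structure GrMod where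
  /-- the underlying right module -/
  toMod : ModuleCat.{u} Aᵐᵒᵖ
  /-- the homogeneous components -/
  component : ℤ → AddSubgroup toMod
  isInternal : DirectSum.IsInternal component
  smul_mem : ∀ (i : ℤ) (n : ℕ) (m : toMod) (a : A), m ∈ component i → a ∈ 𝓐 n →
    MulOpposite.op a • m ∈ component (i + n)

variable {𝓐}

/-- The graded right module `M` is finitely generated. -/
def GrMod.FG (M : GrMod 𝓐) : Prop := Module.Finite Aᵐᵒᵖ M.toMod

/-- A right module homomorphism between graded modules preserves degrees. -/
def GrMod.PreservesDegree {M N : GrMod 𝓐} (f : M.toMod →ₗ[Aᵐᵒᵖ] N.toMod) : Prop :=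
  ∀ (i : ℤ) (m : M.toMod), m ∈ M.component i → f m ∈ N.component i

variable (𝓐)

/-- An `ℕ`-grading as a `ℤ`-grading, with zero components in negative degrees. -/
def intGrading : ℤ → AddSubgroup A
  | Int.ofNat n => (𝓐 n).toAddSubgroup
  | Int.negSucc _ => ⊥

theorem isInternal_intGrading [GradedAlgebra 𝓐] : DirectSum.IsInternal (intGrading 𝓐) := by
  let D : DirectSum ℕ (fun n => 𝓐 n) →+ DirectSum ℤ (fun i => intGrading 𝓐 i) :=
    DirectSum.toAddMonoid fun n =>
      (DirectSum.of (fun i => intGrading 𝓐 i) (Int.ofNat n) :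
        (intGrading 𝓐 (Int.ofNat n)) →+ DirectSum ℤ (fun i => intGrading 𝓐 i))
  have hD (n : ℕ) (x : 𝓐 n) : D (DirectSum.of (fun n => 𝓐 n) n x) =
      DirectSum.of (fun i => intGrading 𝓐 i) (Int.ofNat n) ⟨x.1, x.2⟩ :=
    DirectSum.toAddMonoid_of _ _ _
  have h : DirectSum.Decomposition (intGrading 𝓐) := by
    refine DirectSum.Decomposition.ofAddHom _
      (D.comp (DirectSum.decomposeAddEquiv 𝓐).toAddMonoidHom) ?_ ?_
    · refine AddMonoidHom.ext fun x => ?_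
      induction x using DirectSum.Decomposition.inductionOn 𝓐 with
      | zero => simp
      | add x y hx hy => rw [map_add, map_add, hx, hy]
      | homogeneous x =>
        simp only [AddMonoidHom.comp_apply, AddEquiv.coe_toAddMonoidHom,
          DirectSum.decomposeAddEquiv_apply, DirectSum.decompose_coe, hD,
          DirectSum.coeAddMonoidHom_of, AddMonoidHom.id_apply]
    · refine DirectSum.addHom_ext fun i x => ?_
      match i, x with
      | Int.ofNat n, x =>
        simp only [AddMonoidHom.comp_apply, DirectSum.coeAddMonoidHom_of,
          AddEquiv.coe_toAddMonoidHom, DirectSum.decomposeAddEquiv_apply, AddMonoidHom.id_apply]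
        have hx : (x : A) ∈ 𝓐 n := x.2
        rw [DirectSum.decompose_of_mem 𝓐 hx, hD]
      | Int.negSucc n, x =>
        have hx : x = 0 := Subtype.ext x.2
        rw [hx]
        simp
  exact h.isInternal

/-- The algebra `A` as a graded right module over itself. -/
noncomputable def GrMod.regular [GradedAlgebra 𝓐] : GrMod 𝓐 where
  toMod := ModuleCat.of Aᵐᵒᵖ A
  component := intGrading 𝓐
  isInternal := isInternal_intGrading 𝓐
  smul_mem := by
    rintro (i | i) n m a hm ha
    · exact SetLike.GradedMul.mul_mem (A := 𝓐) hm ha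
    · have hm' : m = 0 := hm
      rw [hm', smul_zero]
      exact AddSubgroup.zero_mem _

variable {𝓐}

/-- Restriction of graded right modules along a degree-preserving algebra homomorphism. -/
noncomputable def GrMod.restrict {B : Type u} [Ring B] [Algebra k B] {𝓑 : ℕ → Submodule k B}
    (φ : A →ₐ[k] B) (hφ : ∀ n a, a ∈ 𝓐 n → φ a ∈ 𝓑 n) (M : GrMod 𝓑) : GrMod 𝓐 where
  toMod := (ModuleCat.restrictScalars (φ : A →+* B).op).obj M.toMod
  component := M.component
  isInternal := M.isInternal
  smul_mem i n m a hm ha := M.smul_mem i n m (φ a) hm (hφ n a ha)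

/-! ## Dimension functions, grade and Cohen-Macaulay properties -/

/-- An exact dimension function on finitely generated graded right `A`-modules:
`∂(M) = max {∂(N), ∂(M/N)}` for every graded submodule `N` of `M`.  This is stated for short
exact sequences `0 → N → M → Q → 0` of graded modules and degree-preserving homomorphisms, so
that `∂` takes the same value on isomorphic graded modules.  The values of `∂` on modules that
are not finitely generated play no role. -/
def IsExactDimension (dim : GrMod 𝓐 → EReal) : Prop :=
  ∀ (N M Q : GrMod 𝓐) (f : N.toMod →ₗ[Aᵐᵒᵖ] M.toMod) (g : M.toMod →ₗ[Aᵐᵒᵖ] Q.toMod),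
    N.FG → M.FG → Q.FG → GrMod.PreservesDegree f → GrMod.PreservesDegree g →
    Function.Injective f → Function.Exact f g → Function.Surjective g →
    dim M = max (dim N) (dim Q)

/-- For a degree-preserving algebra homomorphism `A → B` (in practice the inclusion of a
subalgebra over which `B` is finitely generated as a right module), the dimension functions
`dimA`, `dimB` are `B/A`-hereditary: `∂(M_A) = ∂(M_B)` for every finitely generated graded
right `B`-module `M`. -/
def IsHereditary {B : Type u} [Ring B] [Algebra k B] {𝓑 : ℕ → Submodule k B}
    (φ : A →ₐ[k] B) (hφ : ∀ n a, a ∈ 𝓐 n → φ a ∈ 𝓑 n)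
    (dimA : GrMod 𝓐 → EReal) (dimB : GrMod 𝓑 → EReal) : Prop :=
  ∀ M : GrMod 𝓑, M.FG → dimA (M.restrict φ hφ) = dimB M

/-- The grade `j(M) = min {i | Extⁱ_A(M, A) ≠ 0}` of a right `A`-module, with `j(M) = ∞` if all
these groups vanish. -/
noncomputable def moduleGrade (M : ModuleCat.{u} Aᵐᵒᵖ) : ℕ∞ :=
  ⨅ (i : ℕ) (_ : Nontrivial (Abelian.Ext M (ModuleCat.of Aᵐᵒᵖ A) i)), (i : ℕ∞)

/-- The grade of a graded module, as an extended real number. -/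
noncomputable def GrMod.gradeE (M : GrMod 𝓐) : EReal := ((moduleGrade M.toMod : ENNReal) : EReal)

variable (𝓐) [GradedAlgebra 𝓐]

/-- `A` is (graded) `∂`-Cohen-Macaulay: `∂(A) = d ∈ ℕ` and `j(M) + ∂(M) = ∂(A)` for every
nonzero finitely generated graded right module `M`. -/
def IsCM (dim : GrMod 𝓐 → EReal) : Prop :=
  ∃ d : ℕ, dim (GrMod.regular 𝓐) = (d : EReal) ∧
    ∀ M : GrMod 𝓐, M.FG → Nontrivial M.toMod → M.gradeE + dim M = (d : EReal)

/-- `A` is (graded) `∂`-CM`(s)`: `∂(A) = d ∈ ℕ` and, for every finitely generated graded right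
module `M`, `∂(M) ≤ d - s ↔ j(M) ≥ s`. -/
def IsCMs (dim : GrMod 𝓐 → EReal) (s : ℤ) : Prop :=
  ∃ d : ℕ, dim (GrMod.regular 𝓐) = (d : EReal) ∧
    ∀ M : GrMod 𝓐, M.FG → (dim M ≤ (((d - s : ℤ) : ℝ) : EReal) ↔ ((s : ℝ) : EReal) ≤ M.gradeE)

/-- `A` is (graded) `∂`-CM`ˡ(s)`: `∂(A) = d ∈ ℕ` and, for every finitely generated graded right
module `M`, `∂(M) ≤ d - s → j(M) ≥ s`. -/
def IsCMl (dim : GrMod 𝓐 → EReal) (s : ℤ) : Prop :=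
  ∃ d : ℕ, dim (GrMod.regular 𝓐) = (d : EReal) ∧
    ∀ M : GrMod 𝓐, M.FG → dim M ≤ (((d - s : ℤ) : ℝ) : EReal) → ((s : ℝ) : EReal) ≤ M.gradeE

/-- `A` is (graded) `∂`-CM`ʳ(s)`: `∂(A) = d ∈ ℕ` and, for every finitely generated graded right
module `M`, `j(M) ≥ s → ∂(M) ≤ d - s`. -/
def IsCMr (dim : GrMod 𝓐 → EReal) (s : ℤ) : Prop :=
  ∃ d : ℕ, dim (GrMod.regular 𝓐) = (d : EReal) ∧
    ∀ M : GrMod 𝓐, M.FG → ((s : ℝ) : EReal) ≤ M.gradeE → dim M ≤ (((d - s : ℤ) : ℝ) : EReal)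

end GradedModules

/-- The inclusion `R → R # H` preserves degrees. -/
theorem incl_mem {k H R : Type u} [Field k] [Ring H] [HopfAlgebra k H] [Ring R] [Algebra k R]
    [Module H R] [HopfModuleAlgebra k H R] (𝓡 : ℕ → Submodule k R) (n : ℕ) (r : R)
    (hr : r ∈ 𝓡 n) : SmashProduct.incl k H R r ∈ smashGrading H 𝓡 n :=
  smashGrading.tmul_mem 𝓡 hr 1

/-! The inclusion `R → B = R # H` is a Frobenius extension: there is an `R`-bimodule map `E : B → R`
with finite dual bases. Composition with `E` identifies `Hom_B(M, B)` with `Hom_R(M, R)`, naturally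
in `M`. Moreover `B` is projective as a right `R`-module, so a projective presentation over `B`
restricts to one over `R`. Dimension shifting then shows that `Extⁱ_B(M, B)` and `Extⁱ_R(M, R)`
vanish together (`FrobeniusSystem.subsingleton_ext_iff`), whence `j(M_B) = j(M_R)`.

The map is `E(r # h) = l(h) r` for a Frobenius form `l` on `H`. Semisimplicity supplies a two-sided
integral `t` with `ε(t) = 1` (`exists_integral`). A form with `∑ t₁ l(t₂) = 1` is a left integral of
the dual, which makes `E` right `R`-linear, and it comes with dual bases read off from `Δ(t)`
(`exists_frobenius_form`).

As `∂` is hereditary, dimensions over `B` can be computed over `R`, and only `∂(B) = ∂(R)` remains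
(`SmashProduct.dim_restrict_regular`). Over `R`, the module `B` is generated by finitely many
elements of degree zero, so it is a graded quotient of a finite sum of copies of `R`; conversely it
maps onto `R` by a map of degree zero. Each condition for `B` is then the condition for `R` applied
to restricted modules. -/

/-! ### Integrals and the Frobenius form of a semisimple Hopf algebra -/

section HopfIntegral

variable {k H : Type u} [Field k] [Ring H] [HopfAlgebra k H]

/-- In a semisimple Hopf algebra, a left integral with vanishing counit is zero. -/
theorem leftIntegral_eq_zero [IsSemisimpleRing H] {y : H}
    (hy : ∀ h : H, h * y = Coalgebra.counit (R := k) h • y)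
    (h0 : Coalgebra.counit (R := k) y = 0) : y = 0 := by
  obtain ⟨K, hK⟩ := exists_isCompl (Submodule.span H {y})
  have h1 : (1 : H) ∈ Submodule.span H {y} ⊔ K := hK.sup_eq_top ▸ Submodule.mem_top
  obtain ⟨a, ha, b, hb, hab⟩ := Submodule.mem_sup.1 h1
  obtain ⟨c, rfl⟩ := Submodule.mem_span_singleton.1 ha
  -- With `1 = c y + b` and `b ∈ K`: since `y (c y) = ε(c) ε(y) y = 0`, one gets `y = y b ∈ K`,
  -- while `y` also lies in the complement `H y`.
  have hyy : y * (c • y) = 0 := by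
    rw [smul_eq_mul, hy c, mul_smul_comm, hy y, h0, zero_smul, smul_zero]
  have hyb : y = y * b := by
    conv_lhs => rw [← mul_one y, ← hab, mul_add, hyy, zero_add]
  have : y ∈ Submodule.span H {y} ⊓ K :=
    ⟨Submodule.mem_span_singleton_self y, by rw [hyb]; exact K.smul_mem y hb⟩
  rwa [hK.inf_eq_bot, Submodule.mem_bot] at this

variable (k H) in
/-- A semisimple Hopf algebra has a two-sided integral with counit `1`. -/
theorem exists_integral [IsSemisimpleRing H] : ∃ t : H, Coalgebra.counit (R := k) t = 1 ∧
    (∀ h : H, h * t = Coalgebra.counit (R := k) h • t) ∧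
    (∀ h : H, t * h = Coalgebra.counit (R := k) h • t) := by
  let ε := Bialgebra.counitAlgHom k H
  -- The integral is the component of `1` in a complement `I` of the augmentation ideal: `(h - ε(h))
  -- t` lies in both summands, hence vanishes.
  obtain ⟨I, hI⟩ := exists_isCompl (RingHom.ker ε : Submodule H H)
  have h1 : (1 : H) ∈ (RingHom.ker ε : Submodule H H) ⊔ I := hI.sup_eq_top ▸ Submodule.mem_top
  obtain ⟨e, he, t, ht, het⟩ := Submodule.mem_sup.1 h1
  have hε : ∀ h : H, Coalgebra.counit (R := k) h = ε h := fun _ => rfl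
  have he' : ε e = 0 := he
  have ht1 : ε t = 1 := by
    rw [← map_one ε, ← het, map_add, he', zero_add]
  have hl : ∀ h : H, h * t = ε h • t := by
    intro h
    have hm : (h - algebraMap k H (ε h)) * t ∈ (RingHom.ker ε : Submodule H H) ⊓ I :=
      ⟨by
        change ε _ = 0
        simp only [map_mul, map_sub, AlgHom.commutes, Algebra.algebraMap_self, RingHom.id_apply,
          sub_self, zero_mul], I.smul_mem _ ht⟩
    rw [hI.inf_eq_bot, Submodule.mem_bot, sub_mul, sub_eq_zero] at hm
    rw [hm, Algebra.smul_def]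
  refine ⟨t, ht1, hl, fun h => ?_⟩
  rw [hε]
  -- For fixed `h`, the element `t h - ε(h) t` is again a left integral, and its counit is `ε(h) -
  -- ε(h) = 0`.
  refine sub_eq_zero.1 (leftIntegral_eq_zero (k := k) (fun g => ?_) ?_)
  · rw [hε, mul_sub, ← mul_assoc, hl, smul_mul_assoc, mul_smul_comm, hl g, smul_sub,
      smul_comm (ε h)]
  · rw [hε, map_sub, map_mul, map_smul, ht1, one_mul, smul_eq_mul, mul_one, sub_self]

/-- `∑ (S(h₁) ⊗ 1) Δ(h₂) = 1 ⊗ h`. -/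
theorem antipode_mul_comul (h : H) :
    LinearMap.mul' k (H ⊗[k] H) (TensorProduct.map
      ((TensorProduct.mk k H H).flip 1 ∘ₗ HopfAlgebra.antipode k) Coalgebra.comul
      (Coalgebra.comul h)) = 1 ⊗ₜ h := by
  let F : H ⊗[k] (H ⊗[k] H) →ₗ[k] H ⊗[k] H :=
    (LinearMap.mul' k H ∘ₗ (HopfAlgebra.antipode k).rTensor H).rTensor H ∘ₗ
      (TensorProduct.assoc k H H H).symm.toLinearMap
  have h1 : ∀ z : H ⊗[k] H, LinearMap.mul' k (H ⊗[k] H) (TensorProduct.map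
      ((TensorProduct.mk k H H).flip 1 ∘ₗ HopfAlgebra.antipode k) Coalgebra.comul z) =
      F (Coalgebra.comul.lTensor H z) := by
    intro z
    induction z using TensorProduct.induction_on with
    | zero => simp
    | add x y hx hy => simp only [map_add, hx, hy]
    | tmul x y =>
      rw [TensorProduct.map_tmul, LinearMap.lTensor_tmul]
      induction (Coalgebra.comul y : H ⊗[k] H) using TensorProduct.induction_on with
      | zero => simp
      | add x y hx hy => simp only [map_add, TensorProduct.tmul_add, LinearMap.mul'_apply] at hx hy ⊢; rw [hx, hy]
      | tmul a b => simp [F]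
  have h2 : ∀ z : H ⊗[k] H, F (TensorProduct.assoc k H H H (Coalgebra.comul.rTensor H z)) =
      (Algebra.linearMap k H).rTensor H (Coalgebra.counit.rTensor H z) := by
    intro z
    induction z using TensorProduct.induction_on with
    | zero => simp
    | add x y hx hy => simp only [map_add, hx, hy]
    | tmul x y => simp [F]
  rw [h1, ← Coalgebra.coassoc_apply, h2, Coalgebra.rTensor_counit_comul]
  simp

/-- `∑ Δ(h₁) (1 ⊗ S(h₂)) = h ⊗ 1`. -/
theorem comul_mul_antipode (h : H) :
    LinearMap.mul' k (H ⊗[k] H) (TensorProduct.map Coalgebra.comul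
      (TensorProduct.mk k H H 1 ∘ₗ HopfAlgebra.antipode k)
      (Coalgebra.comul h)) = h ⊗ₜ 1 := by
  let F : H ⊗[k] (H ⊗[k] H) →ₗ[k] H ⊗[k] H :=
    (LinearMap.mul' k H ∘ₗ (HopfAlgebra.antipode k).lTensor H).lTensor H
  have h1 : ∀ z : H ⊗[k] H, LinearMap.mul' k (H ⊗[k] H) (TensorProduct.map Coalgebra.comul
      (TensorProduct.mk k H H 1 ∘ₗ HopfAlgebra.antipode k) z) =
      F (TensorProduct.assoc k H H H (Coalgebra.comul.rTensor H z)) := by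
    intro z
    induction z using TensorProduct.induction_on with
    | zero => simp
    | add x y hx hy => simp only [map_add, hx, hy]
    | tmul x y =>
      rw [TensorProduct.map_tmul, LinearMap.rTensor_tmul]
      induction (Coalgebra.comul x : H ⊗[k] H) using TensorProduct.induction_on with
      | zero => simp
      | add x y hx hy => simp only [map_add, TensorProduct.add_tmul, LinearMap.mul'_apply] at hx hy ⊢; rw [hx, hy]
      | tmul a b => simp [F]
  have h2 : ∀ z : H ⊗[k] H, F (Coalgebra.comul.lTensor H z) =
      (Algebra.linearMap k H).lTensor H (Coalgebra.counit.lTensor H z) := by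
    intro z
    induction z using TensorProduct.induction_on with
    | zero => simp
    | add x y hx hy => simp only [map_add, hx, hy]
    | tmul x y => simp [F]
  rw [h1, Coalgebra.coassoc_apply, h2, Coalgebra.lTensor_counit_comul]
  simp

/-- By `antipode_mul_comul`, `(1 ⊗ h) Δ(t) = ∑ (S(h₁) ⊗ 1) Δ(h₂ t)`, and `h₂ t = ε(h₂) t`. -/
theorem tmul_mul_comul_leftIntegral {t : H}
    (ht : ∀ h : H, h * t = Coalgebra.counit (R := k) h • t) (h : H) :
    (1 ⊗ₜ[k] h) * Coalgebra.comul (R := k) t =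
      (HopfAlgebra.antipode k h ⊗ₜ 1) * Coalgebra.comul (R := k) t := by
  have key : ∀ z : H ⊗[k] H, LinearMap.mul' k (H ⊗[k] H) (TensorProduct.map
      ((TensorProduct.mk k H H).flip 1 ∘ₗ HopfAlgebra.antipode k) Coalgebra.comul z) *
        Coalgebra.comul (R := k) t =
      (HopfAlgebra.antipode k (TensorProduct.rid k H (Coalgebra.counit.lTensor H z)) ⊗ₜ 1) *
        Coalgebra.comul (R := k) t := by
    intro z
    induction z using TensorProduct.induction_on with
    | zero => simp
    | add x y hx hy => simp only [map_add, add_mul, TensorProduct.add_tmul, hx, hy]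
    | tmul x y =>
      simp only [TensorProduct.map_tmul, LinearMap.mul'_apply, LinearMap.lTensor_tmul,
        TensorProduct.rid_tmul, map_smul, mul_assoc]
      rw [← Bialgebra.comul_mul, ht, map_smul, mul_smul_comm, ← TensorProduct.smul_tmul',
        smul_mul_assoc]
      rfl
  have := key (Coalgebra.comul h)
  rw [antipode_mul_comul, Coalgebra.lTensor_counit_comul] at this
  simpa using this

/-- By `comul_mul_antipode`, `Δ(t) (h ⊗ 1) = ∑ Δ(t h₁) (1 ⊗ S(h₂))`, and `t h₁ = ε(h₁) t`. -/
theorem comul_rightIntegral_mul_tmul {t : H}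
    (ht : ∀ h : H, t * h = Coalgebra.counit (R := k) h • t) (h : H) :
    Coalgebra.comul (R := k) t * (h ⊗ₜ[k] 1) =
      Coalgebra.comul (R := k) t * (1 ⊗ₜ HopfAlgebra.antipode k h) := by
  have key : ∀ z : H ⊗[k] H, Coalgebra.comul (R := k) t *
      LinearMap.mul' k (H ⊗[k] H) (TensorProduct.map Coalgebra.comul
      (TensorProduct.mk k H H 1 ∘ₗ HopfAlgebra.antipode k) z) =
      Coalgebra.comul (R := k) t *
        (1 ⊗ₜ HopfAlgebra.antipode k (TensorProduct.lid k H (Coalgebra.counit.rTensor H z))) := by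
    intro z
    induction z using TensorProduct.induction_on with
    | zero => simp
    | add x y hx hy => simp only [map_add, mul_add, TensorProduct.tmul_add, hx, hy]
    | tmul x y =>
      simp only [TensorProduct.map_tmul, LinearMap.mul'_apply, LinearMap.rTensor_tmul,
        TensorProduct.lid_tmul, map_smul, ← mul_assoc]
      rw [← Bialgebra.comul_mul, ht, map_smul, smul_mul_assoc, TensorProduct.tmul_smul,
        mul_smul_comm]
      rfl
  have := key (Coalgebra.comul h)
  rw [comul_mul_antipode, Coalgebra.rTensor_counit_comul] at this
  simpa using this


theorem sum_rid_lTensor_coord {ι : Type*} [Fintype ι] (b : Module.Basis ι k H) (z : H ⊗[k] H) :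
    ∑ i, TensorProduct.rid k H ((b.coord i).lTensor H z) ⊗ₜ[k] b i = z := by
  induction z using TensorProduct.induction_on with
  | zero => simp
  | add x y hx hy => simp only [map_add, TensorProduct.add_tmul, Finset.sum_add_distrib, hx, hy]
  | tmul x y =>
    simp only [LinearMap.lTensor_tmul, TensorProduct.rid_tmul, Module.Basis.coord_apply,
      TensorProduct.smul_tmul]
    rw [← TensorProduct.tmul_sum, b.sum_repr]

theorem sum_lid_rTensor_coord {ι : Type*} [Fintype ι] (b : Module.Basis ι k H) (z : H ⊗[k] H) :
    ∑ i, b i ⊗ₜ[k] TensorProduct.lid k H ((b.coord i).rTensor H z) = z := by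
  induction z using TensorProduct.induction_on with
  | zero => simp
  | add x y hx hy => simp only [map_add, TensorProduct.tmul_add, Finset.sum_add_distrib, hx, hy]
  | tmul x y =>
    simp only [LinearMap.rTensor_tmul, TensorProduct.lid_tmul, Module.Basis.coord_apply,
      ← TensorProduct.smul_tmul]
    rw [← TensorProduct.sum_tmul, b.sum_repr]

/-- The left tensor components of `Δ(t)` exhaust `H`. -/
theorem exists_rid_lTensor_comul_eq [FiniteDimensional k H] {t : H}
    (ht1 : Coalgebra.counit (R := k) t = 1)
    (ht : ∀ h : H, t * h = Coalgebra.counit (R := k) h • t) (h : H) :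
    ∃ f : H →ₗ[k] k, TensorProduct.rid k H (f.lTensor H (Coalgebra.comul t)) = h := by
  -- The elements `∑ f(t₂) t₁` form a right ideal: a factor `h` on the right of `t₁` moves to `S(h)`
  -- on the right of `t₂`.
  have hmul (f : H →ₗ[k] k) (h : H) :
      TensorProduct.rid k H (f.lTensor H (Coalgebra.comul t)) * h =
      TensorProduct.rid k H ((f ∘ₗ LinearMap.mulRight k (HopfAlgebra.antipode k h)).lTensor H
        (Coalgebra.comul t)) := by
    have h1 : ∀ z : H ⊗[k] H, TensorProduct.rid k H (f.lTensor H z) * h =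
        TensorProduct.rid k H (f.lTensor H (z * (h ⊗ₜ 1))) := by
      intro z
      induction z using TensorProduct.induction_on with
      | zero => simp
      | add x y hx hy => simp only [map_add, add_mul, hx, hy]
      | tmul x y => simp
    have h2 : ∀ z : H ⊗[k] H,
        TensorProduct.rid k H (f.lTensor H (z * (1 ⊗ₜ HopfAlgebra.antipode k h))) =
        TensorProduct.rid k H
          ((f ∘ₗ LinearMap.mulRight k (HopfAlgebra.antipode k h)).lTensor H z) := by
      intro z
      induction z using TensorProduct.induction_on with
      | zero => simp
      | add x y hx hy => simp only [map_add, add_mul, hx, hy]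
      | tmul x y => simp
    rw [h1, comul_rightIntegral_mul_tmul ht, h2]
  have hadd (s : Finset (Fin (Module.finrank k H))) (F : Fin (Module.finrank k H) → H →ₗ[k] k) :
      TensorProduct.rid k H ((∑ i ∈ s, F i).lTensor H (Coalgebra.comul t)) =
      ∑ i ∈ s, TensorProduct.rid k H ((F i).lTensor H (Coalgebra.comul t)) := by
    rw [← LinearMap.coe_lTensorHom, map_sum, LinearMap.sum_apply, map_sum]
  let b := Module.finBasis k H
  have h1 := HopfAlgebra.mul_antipode_lTensor_comul_apply (R := k) t
  rw [ht1, map_one] at h1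
  rw [← sum_rid_lTensor_coord b (Coalgebra.comul t)] at h1
  simp only [map_sum, LinearMap.lTensor_tmul, LinearMap.mul'_apply] at h1
  -- With `Δ(t) = ∑ aᵢ ⊗ bᵢ`, the identity `∑ aᵢ S(bᵢ) = ε(t) = 1` gives `h = ∑ aᵢ (S(bᵢ) h)`, a
  -- member of the right ideal because every `aᵢ` is.
  refine ⟨∑ i, b.coord i ∘ₗ LinearMap.mulRight k
    (HopfAlgebra.antipode k (HopfAlgebra.antipode k (b i) * h)), ?_⟩
  rw [hadd]
  simp only [← hmul, ← mul_assoc]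
  rw [← Finset.sum_mul, h1, one_mul]

/-- The right tensor components of `Δ(t)` exhaust `H`. -/
theorem exists_lid_rTensor_comul_eq [FiniteDimensional k H] {t : H}
    (ht1 : Coalgebra.counit (R := k) t = 1)
    (ht : ∀ h : H, h * t = Coalgebra.counit (R := k) h • t) (h : H) :
    ∃ f : H →ₗ[k] k, TensorProduct.lid k H (f.rTensor H (Coalgebra.comul t)) = h := by
  -- Mirror image: the elements `∑ f(t₁) t₂` form a left ideal, which contains `1 = ∑ S(t₁) t₂`.
  have hmul (f : H →ₗ[k] k) (h : H) :
      h * TensorProduct.lid k H (f.rTensor H (Coalgebra.comul t)) =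
      TensorProduct.lid k H ((f ∘ₗ LinearMap.mulLeft k (HopfAlgebra.antipode k h)).rTensor H
        (Coalgebra.comul t)) := by
    have h1 : ∀ z : H ⊗[k] H, h * TensorProduct.lid k H (f.rTensor H z) =
        TensorProduct.lid k H (f.rTensor H ((1 ⊗ₜ h) * z)) := by
      intro z
      induction z using TensorProduct.induction_on with
      | zero => simp
      | add x y hx hy => simp only [map_add, mul_add, hx, hy]
      | tmul x y => simp
    have h2 : ∀ z : H ⊗[k] H,
        TensorProduct.lid k H (f.rTensor H ((HopfAlgebra.antipode k h ⊗ₜ 1) * z)) =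
        TensorProduct.lid k H
          ((f ∘ₗ LinearMap.mulLeft k (HopfAlgebra.antipode k h)).rTensor H z) := by
      intro z
      induction z using TensorProduct.induction_on with
      | zero => simp
      | add x y hx hy => simp only [map_add, mul_add, hx, hy]
      | tmul x y => simp
    rw [h1, tmul_mul_comul_leftIntegral ht, h2]
  have hadd (s : Finset (Fin (Module.finrank k H))) (F : Fin (Module.finrank k H) → H →ₗ[k] k) :
      TensorProduct.lid k H ((∑ i ∈ s, F i).rTensor H (Coalgebra.comul t)) =
      ∑ i ∈ s, TensorProduct.lid k H ((F i).rTensor H (Coalgebra.comul t)) := by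
    rw [← LinearMap.coe_rTensorHom, map_sum, LinearMap.sum_apply, map_sum]
  let b := Module.finBasis k H
  have h1 := HopfAlgebra.mul_antipode_rTensor_comul_apply (R := k) t
  rw [ht1, map_one] at h1
  rw [← sum_lid_rTensor_coord b (Coalgebra.comul t)] at h1
  simp only [map_sum, LinearMap.rTensor_tmul, LinearMap.mul'_apply] at h1
  refine ⟨∑ i, b.coord i ∘ₗ LinearMap.mulLeft k
    (HopfAlgebra.antipode k (h * HopfAlgebra.antipode k (b i))), ?_⟩
  rw [hadd]
  simp only [← hmul, mul_assoc]
  rw [← Finset.mul_sum, h1, mul_one]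

variable (k H) in
/-- The antipode of a finite-dimensional semisimple Hopf algebra is surjective. -/
theorem antipode_surjective [FiniteDimensional k H] [IsSemisimpleRing H] :
    Function.Surjective (HopfAlgebra.antipode k : H →ₗ[k] H) := by
  refine LinearMap.surjective_of_injective ((injective_iff_map_eq_zero _).2 fun h hh => ?_)
  -- If `S(h) = 0` then `Δ(t) (h ⊗ 1) = 0`; applying a form `f` with `∑ f(t₂) t₁ = 1` to the second
  -- factor leaves `h = 0`.
  obtain ⟨t, ht1, -, htr⟩ := exists_integral k H
  obtain ⟨f, hf⟩ := exists_rid_lTensor_comul_eq ht1 htr (1 : H)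
  have h0 := comul_rightIntegral_mul_tmul htr h
  rw [hh, TensorProduct.tmul_zero, mul_zero] at h0
  have h1 : ∀ z : H ⊗[k] H, TensorProduct.rid k H (f.lTensor H z) * h =
      TensorProduct.rid k H (f.lTensor H (z * (h ⊗ₜ 1))) := by
    intro z
    induction z using TensorProduct.induction_on with
    | zero => simp
    | add x y hx hy => simp only [map_add, add_mul, hx, hy]
    | tmul x y => simp
  rw [← one_mul h, ← hf, h1, h0, map_zero, map_zero]

variable (k H) in
/-- A finite-dimensional semisimple Hopf algebra is Frobenius, with Frobenius form a left
integral of the dual. -/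
theorem exists_frobenius_form [FiniteDimensional k H] [IsSemisimpleRing H] :
    ∃ (l : H →ₗ[k] k) (n : ℕ) (x y : Fin n → H),
      (∀ h : H, TensorProduct.rid k H (l.lTensor H (Coalgebra.comul h)) = l h • 1) ∧
      (∀ h : H, ∑ i, l (y i * h) • x i = h) ∧ (∀ h : H, ∑ i, l (h * x i) • y i = h) := by
  obtain ⟨t, ht1, htl, htr⟩ := exists_integral k H
  obtain ⟨l, hl⟩ := exists_rid_lTensor_comul_eq ht1 htr (1 : H)
  let b := Module.finBasis k H
  let a : Fin (Module.finrank k H) → H :=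
    fun i => TensorProduct.rid k H ((b.coord i).lTensor H (Coalgebra.comul t))
  have hT : ∑ i, a i ⊗ₜ[k] b i = Coalgebra.comul t := sum_rid_lTensor_coord b _
  -- Write `h = S(g)`. Applying `l` to the second factor of `Δ(t) (g ⊗ 1) = Δ(t) (1 ⊗ S(g))` yields
  -- `g = ∑ l(bᵢ h) aᵢ`, and `S` of this is the claim.
  have hx (h : H) : ∑ i, l (b i * h) • HopfAlgebra.antipode k (a i) = h := by
    obtain ⟨g, rfl⟩ := antipode_surjective k H h
    have h1 := comul_rightIntegral_mul_tmul htr g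
    rw [← hT] at h1 hl
    simp only [Finset.sum_mul, Algebra.TensorProduct.tmul_mul_tmul, mul_one] at h1
    have h2 := congrArg (fun z => TensorProduct.rid k H (l.lTensor H z)) h1
    simp only [map_sum, LinearMap.lTensor_tmul, TensorProduct.rid_tmul] at h2 hl
    simp only [← smul_mul_assoc] at h2
    rw [← Finset.sum_mul, hl, one_mul] at h2
    conv_rhs => rw [h2]
    rw [map_sum]
    simp
  refine ⟨l, _, fun i => HopfAlgebra.antipode k (a i), b, fun h => ?_, hx, fun h => ?_⟩
  -- The integral property is `P = Q`, where `P h = ∑ l(h₂) h₁` and `Q h = l(h) 1`. Both `id ⊗ P`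
  -- and `id ⊗ Q` send `Δ(t)` to `1 ⊗ 1` (for `P`, coassociativity turns the value into `Δ(1)`), and
  -- the right components of `Δ(t)` exhaust `H`.
  · let P : H →ₗ[k] H :=
      (TensorProduct.rid k H).toLinearMap ∘ₗ l.lTensor H ∘ₗ Coalgebra.comul
    let Q : H →ₗ[k] H := (LinearMap.toSpanSingleton k H 1) ∘ₗ l
    have hP : P.lTensor H (Coalgebra.comul t) = 1 ⊗ₜ 1 := by
      have h1 : ∀ z : H ⊗[k] (H ⊗[k] H), ((TensorProduct.rid k H).toLinearMap ∘ₗ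
          l.lTensor H).lTensor H z = (TensorProduct.rid k (H ⊗[k] H)) (l.lTensor (H ⊗[k] H)
            ((TensorProduct.assoc k H H H).symm z)) := by
        intro z
        induction z using TensorProduct.induction_on with
        | zero => simp
        | add x y hx hy => simp only [map_add, hx, hy]
        | tmul x y =>
          induction y using TensorProduct.induction_on with
          | zero => simp
          | add x y hx hy => simp only [map_add, TensorProduct.tmul_add, hx, hy]
          | tmul a b => simp
      have h2 : ∀ z : H ⊗[k] H, (TensorProduct.rid k (H ⊗[k] H)) (l.lTensor (H ⊗[k] H)
          (Coalgebra.comul.rTensor H z)) =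
          Coalgebra.comul (TensorProduct.rid k H (l.lTensor H z)) := by
        intro z
        induction z using TensorProduct.induction_on with
        | zero => simp
        | add x y hx hy => simp only [map_add, hx, hy]
        | tmul x y => simp
      have h3 : P.lTensor H (Coalgebra.comul t) = ((TensorProduct.rid k H).toLinearMap ∘ₗ
          l.lTensor H).lTensor H (Coalgebra.comul.lTensor H (Coalgebra.comul t)) := by
        rw [← LinearMap.lTensor_comp_apply]
        rfl
      rw [h3, h1, Coalgebra.coassoc_symm_apply, h2, hl, Bialgebra.comul_one]
      rfl
    have hQ : Q.lTensor H (Coalgebra.comul t) = 1 ⊗ₜ 1 := by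
      have h1 : ∀ z : H ⊗[k] H, Q.lTensor H z =
          (TensorProduct.rid k H (l.lTensor H z)) ⊗ₜ 1 := by
        intro z
        induction z using TensorProduct.induction_on with
        | zero => simp
        | add x y hx hy => simp only [map_add, TensorProduct.add_tmul, hx, hy]
        | tmul x y => simp [Q, TensorProduct.smul_tmul]
      rw [h1, hl]
    obtain ⟨f, hf⟩ := exists_lid_rTensor_comul_eq ht1 htl h
    have h1 (G : H →ₗ[k] H) : ∀ z : H ⊗[k] H, G (TensorProduct.lid k H (f.rTensor H z)) =
        TensorProduct.lid k H (f.rTensor H (G.lTensor H z)) := by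
      intro z
      induction z using TensorProduct.induction_on with
      | zero => simp
      | add x y hx hy => simp only [map_add, hx, hy]
      | tmul x y => simp
    change P h = Q h
    rw [← hf, h1, h1, hP, hQ]
  -- The first expansion makes `g ↦ l(- g)` injective, hence bijective onto the dual. The second
  -- expansion may therefore be tested under the forms `l(- g)`, where it follows from the first.
  · let θ : H →ₗ[k] (H →ₗ[k] k) := ((LinearMap.mul k H).compr₂ l).flip
    have hθi : Function.Injective θ := by
      refine (injective_iff_map_eq_zero _).2 fun g hg => ?_
      rw [← hx g]
      refine Finset.sum_eq_zero fun i _ => ?_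
      have : l (b i * g) = θ g (b i) := rfl
      rw [this, hg, LinearMap.zero_apply, zero_smul]
    have hθ : Function.Surjective θ :=
      (LinearMap.injective_iff_surjective_of_finrank_eq_finrank
        (Subspace.dual_finrank_eq (K := k) (V := H)).symm).1 hθi
    refine sub_eq_zero.1 ((Module.forall_dual_apply_eq_zero_iff k _).1 fun f => ?_)
    obtain ⟨g, rfl⟩ := hθ f
    change l ((_ - h) * g) = 0
    conv_lhs => rw [sub_mul, map_sub, ← hx g]
    rw [sub_eq_zero]
    conv_lhs => rw [hx g]
    simp only [Finset.sum_mul, Finset.mul_sum, map_sum, smul_mul_assoc, mul_smul_comm, map_smul,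
      smul_eq_mul]
    exact Finset.sum_congr rfl fun i _ => mul_comm _ _

end HopfIntegral

/-! ### The Frobenius extension `R → R # H` -/

/-- A Frobenius system for a ring homomorphism `φ : R → B`: an `R`-bimodule homomorphism
`E : B → R` with dual bases `x`, `y`. -/
structure FrobeniusSystem {R B : Type u} [Ring R] [Ring B] (φ : R →+* B) where
  /-- the number of elements of the dual bases -/
  size : ℕ
  /-- the Frobenius homomorphism -/
  form : B →+ R
  /-- the basis of `B` as a right `R`-module -/
  x : Fin size → B
  /-- the basis of `B` as a left `R`-module -/
  y : Fin size → B
  form_left : ∀ r b, form (φ r * b) = r * form b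
  form_right : ∀ r b, form (b * φ r) = form b * r
  sum_right : ∀ b, ∑ i, x i * φ (form (y i * b)) = b
  sum_left : ∀ b, ∑ i, φ (form (b * x i)) * y i = b

namespace SmashProduct

variable {k H R : Type u} [Field k] [Ring H] [HopfAlgebra k H] [Ring R] [Algebra k R]

theorem induction {p : SmashProduct k H R → Prop} (hz : p 0) (hm : ∀ r h, p (mk k H R r h))
    (ha : ∀ a b, p a → p b → p (a + b)) (b : SmashProduct k H R) : p b :=
  TensorProduct.induction_on (motive := p) b hz hm ha

/-- The map `r # h ↦ l(h) r` given by a linear form `l` on `H`. -/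
noncomputable def formMap (l : H →ₗ[k] k) : SmashProduct k H R →ₗ[k] R :=
  (TensorProduct.rid k R).toLinearMap ∘ₗ l.lTensor R

theorem formMap_mk (l : H →ₗ[k] k) (r : R) (h : H) :
    formMap l (mk k H R r h) = l h • r := by
  change TensorProduct.rid k R (l.lTensor R (r ⊗ₜ h)) = _
  simp

variable [Module H R] [HopfModuleAlgebra k H R]

theorem incl_mul_mk (r s : R) (h : H) :
    incl k H R r * mk k H R s h = mk k H R (r * s) h := mk_mul_mk_one r s h

theorem formMap_incl_mul (l : H →ₗ[k] k) (r : R) (b : SmashProduct k H R) :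
    formMap l (incl k H R r * b) = r * formMap l b := by
  induction b using SmashProduct.induction with
  | hz => simp
  | ha a b h1 h2 => simp only [mul_add, map_add, h1, h2]
  | hm s h => rw [incl_mul_mk, formMap_mk, formMap_mk, mul_smul_comm]

/-- The form sends `(s # h)(r # 1) = ∑ s (h₁ ⬝ r) # h₂` to `s ((∑ l(h₂) h₁) ⬝ r)`. The integral
property of `l` collapses the inner sum to `l(h) 1`. -/
theorem formMap_mul_incl {l : H →ₗ[k] k}
    (hl : ∀ h : H, TensorProduct.rid k H (l.lTensor H (Coalgebra.comul h)) = l h • 1)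
    (r : R) (b : SmashProduct k H R) :
    formMap l (b * incl k H R r) = formMap l b * r := by
  induction b using SmashProduct.induction with
  | hz => simp
  | ha a b h1 h2 => simp only [add_mul, map_add, h1, h2]
  | hm s h =>
    have h1 : ∀ z : H ⊗[k] H, TensorProduct.rid k R (l.lTensor R (TensorProduct.map
        (LinearMap.mulLeft k s ∘ₗ (LinearMap.toSpanSingleton H R r).restrictScalars k)
        (LinearMap.mulRight k 1) z)) =
        s * (TensorProduct.rid k H (l.lTensor H z) • r) := by
      intro z
      induction z using TensorProduct.induction_on with
      | zero => simp
      | add x y hx hy => simp only [map_add, add_smul, mul_add, hx, hy]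
      | tmul x y => simp
    have h2 := h1 (Coalgebra.comul h)
    rw [hl, smul_assoc, one_smul, mul_smul_comm] at h2
    rw [formMap_mk, smul_mul_assoc, ← h2]
    exact congrArg (formMap l) (mk_mul_mk s r h 1)

variable (k H R) in
/-- The inclusion `H → R # H`, `h ↦ 1 # h`. -/
noncomputable def inclHopf : H →ₐ[k] SmashProduct k H R :=
  AlgHom.ofLinearMap (TensorProduct.mk k R H 1 : H →ₗ[k] R ⊗[k] H) rfl (fun h g => by
    have h1 : ∀ z : H ⊗[k] H, TensorProduct.map (LinearMap.mulLeft k (1 : R) ∘ₗ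
        (LinearMap.toSpanSingleton H R (1 : R)).restrictScalars k) (LinearMap.mulRight k g) z =
        TensorProduct.map (Algebra.linearMap k R) (LinearMap.mulRight k g)
          (Coalgebra.counit.rTensor H z) := by
      intro z
      induction z using TensorProduct.induction_on with
      | zero => simp
      | add x y hx hy => simp only [map_add, hx, hy]
      | tmul x y => simp [HopfModuleAlgebra.hopf_smul_one (k := k) x]
    have h2 := h1 (Coalgebra.comul h)
    rw [Coalgebra.rTensor_counit_comul] at h2
    have h3 : TensorProduct.map (Algebra.linearMap k R) (LinearMap.mulRight k g)
        ((1 : k) ⊗ₜ[k] h) = 1 ⊗ₜ (h * g) := by simp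
    exact ((mk_mul_mk (1 : R) 1 h g).trans (h2.trans h3)).symm)

theorem inclHopf_apply (h : H) : inclHopf k H R h = mk k H R 1 h := rfl

theorem incl_mul_inclHopf (r : R) (h : H) :
    incl k H R r * inclHopf k H R h = mk k H R r h := by
  rw [inclHopf_apply, incl_mul_mk, mul_one]

/-- `h r = ∑ (h₁ ⬝ r) h₂` in `R # H`. -/
theorem inclHopf_mul_incl (h : H) (r : R) :
    inclHopf k H R h * incl k H R r =
      LinearMap.mul' k (SmashProduct k H R) (TensorProduct.map
        ((incl k H R).toLinearMap ∘ₗ (LinearMap.toSpanSingleton H R r).restrictScalars k)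
        (inclHopf k H R).toLinearMap (Coalgebra.comul h)) := by
  refine (mk_mul_mk 1 r h 1).trans ?_
  induction (Coalgebra.comul h : H ⊗[k] H) using TensorProduct.induction_on with
  | zero => simp; rfl
  | add x y hx hy => rw [map_add, map_add, map_add, ← hx, ← hy]; rfl
  | tmul x y =>
    rw [TensorProduct.map_tmul, TensorProduct.map_tmul, LinearMap.mul'_apply]
    refine Eq.trans ?_ (incl_mul_inclHopf (x • r) y).symm
    change _ = (x • r) ⊗ₜ[k] y
    simp

open WithConv in
/-- `r S(h) = ∑ S(h₁) (h₂ ⬝ r)` in `R # H`. -/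
theorem incl_mul_inclHopf_antipode (h : H) (r : R) :
    incl k H R r * inclHopf k H R (HopfAlgebra.antipode k h) =
      LinearMap.mul' k (SmashProduct k H R) (TensorProduct.map
        ((inclHopf k H R).toLinearMap ∘ₗ HopfAlgebra.antipode k)
        ((incl k H R).toLinearMap ∘ₗ (LinearMap.toSpanSingleton H R r).restrictScalars k)
        (Coalgebra.comul h)) := by
  let B := SmashProduct k H R
  -- In the convolution algebra of maps `H → B`: `α * ι = ι(-) r` is the commutation rule, `σ *
  -- (ι(-) r) = ε(-) r`, and `ι * σ = 1`. Hence `σ * α = σ * (α * ι) * σ = (ε(-) r) * σ = r σ(-)`.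
  let ι : WithConv (H →ₗ[k] B) := toConv (inclHopf k H R).toLinearMap
  let σ : WithConv (H →ₗ[k] B) :=
    toConv ((inclHopf k H R).toLinearMap ∘ₗ HopfAlgebra.antipode k)
  let α : WithConv (H →ₗ[k] B) := toConv
    ((incl k H R).toLinearMap ∘ₗ (LinearMap.toSpanSingleton H R r).restrictScalars k)
  have hισ : ι * σ = 1 := by
    refine WithConv.ext (LinearMap.ext fun g => ?_)
    change LinearMap.mul' k B (TensorProduct.map (inclHopf k H R).toLinearMap
      ((inclHopf k H R).toLinearMap ∘ₗ HopfAlgebra.antipode k) (Coalgebra.comul g)) =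
      algebraMap k B (Coalgebra.counit g)
    have : ∀ z : H ⊗[k] H, LinearMap.mul' k B (TensorProduct.map (inclHopf k H R).toLinearMap
        ((inclHopf k H R).toLinearMap ∘ₗ HopfAlgebra.antipode k) z) =
        inclHopf k H R (LinearMap.mul' k H ((HopfAlgebra.antipode k).lTensor H z)) := by
      intro z
      induction z using TensorProduct.induction_on with
      | zero => simp
      | add x y hx hy => simp only [map_add, hx, hy]
      | tmul x y => simp
    rw [this, HopfAlgebra.mul_antipode_lTensor_comul_apply, AlgHom.commutes]
  have hσι : σ * toConv (LinearMap.mulRight k (incl k H R r) ∘ₗ (inclHopf k H R).toLinearMap) =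
      toConv ((LinearMap.toSpanSingleton k B (incl k H R r)) ∘ₗ Coalgebra.counit) := by
    refine WithConv.ext (LinearMap.ext fun g => ?_)
    change LinearMap.mul' k B (TensorProduct.map
      ((inclHopf k H R).toLinearMap ∘ₗ HopfAlgebra.antipode k)
      (LinearMap.mulRight k (incl k H R r) ∘ₗ (inclHopf k H R).toLinearMap)
      (Coalgebra.comul g)) = Coalgebra.counit (R := k) g • incl k H R r
    have : ∀ z : H ⊗[k] H, LinearMap.mul' k B (TensorProduct.map
        ((inclHopf k H R).toLinearMap ∘ₗ HopfAlgebra.antipode k)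
        (LinearMap.mulRight k (incl k H R r) ∘ₗ (inclHopf k H R).toLinearMap) z) =
        inclHopf k H R (LinearMap.mul' k H ((HopfAlgebra.antipode k).rTensor H z)) *
          incl k H R r := by
      intro z
      induction z using TensorProduct.induction_on with
      | zero => simp
      | add x y hx hy => simp only [map_add, add_mul, hx, hy]
      | tmul x y => simp [mul_assoc]
    rw [this, HopfAlgebra.mul_antipode_rTensor_comul_apply, AlgHom.commutes, Algebra.smul_def]
  have hαι : α * ι =
      toConv (LinearMap.mulRight k (incl k H R r) ∘ₗ (inclHopf k H R).toLinearMap) :=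
    WithConv.ext (LinearMap.ext fun g => (inclHopf_mul_incl g r).symm)
  have hc : toConv ((LinearMap.toSpanSingleton k B (incl k H R r)) ∘ₗ Coalgebra.counit) * σ =
      toConv (LinearMap.mulLeft k (incl k H R r) ∘ₗ
        (inclHopf k H R).toLinearMap ∘ₗ HopfAlgebra.antipode k) := by
    refine WithConv.ext (LinearMap.ext fun g => ?_)
    change LinearMap.mul' k B (TensorProduct.map
      ((LinearMap.toSpanSingleton k B (incl k H R r)) ∘ₗ Coalgebra.counit)
      ((inclHopf k H R).toLinearMap ∘ₗ HopfAlgebra.antipode k)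
      (Coalgebra.comul g)) = incl k H R r * inclHopf k H R (HopfAlgebra.antipode k g)
    have : ∀ z : H ⊗[k] H, LinearMap.mul' k B (TensorProduct.map
        ((LinearMap.toSpanSingleton k B (incl k H R r)) ∘ₗ Coalgebra.counit)
        ((inclHopf k H R).toLinearMap ∘ₗ HopfAlgebra.antipode k) z) =
        incl k H R r * inclHopf k H R (HopfAlgebra.antipode k
          (TensorProduct.lid k H (Coalgebra.counit.rTensor H z))) := by
      intro z
      induction z using TensorProduct.induction_on with
      | zero => simp
      | add x y hx hy => simp only [map_add, mul_add, hx, hy]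
      | tmul x y => simp
    rw [this, Coalgebra.rTensor_counit_comul]
    simp
  have key : σ * α = toConv (LinearMap.mulLeft k (incl k H R r) ∘ₗ
        (inclHopf k H R).toLinearMap ∘ₗ HopfAlgebra.antipode k) := by
    rw [← hc, ← hσι, ← hαι, mul_assoc, mul_assoc, hισ, mul_one]
  exact (LinearMap.congr_fun (congrArg WithConv.ofConv key) h).symm

variable [FiniteDimensional k H] [IsSemisimpleRing H]

/-- `R # H` is spanned by the products `h r`. -/
theorem mem_span_inclHopf_mul_incl (b : SmashProduct k H R) :
    b ∈ Submodule.span k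
      (Set.range fun p : H × R => inclHopf k H R p.1 * incl k H R p.2) := by
  induction b using SmashProduct.induction with
  | hz => exact Submodule.zero_mem _
  | ha a b h1 h2 => exact Submodule.add_mem _ h1 h2
  | hm r h =>
    -- Surjectivity of the antipode allows every `r h` to be rewritten by `r S(g) = ∑ S(g₁) (g₂ ⬝
    -- r)`.
    obtain ⟨g, rfl⟩ := antipode_surjective k H h
    rw [← incl_mul_inclHopf, incl_mul_inclHopf_antipode]
    induction (Coalgebra.comul g : H ⊗[k] H) using TensorProduct.induction_on with
    | zero => simp
    | add x y hx hy => rw [map_add, map_add]; exact Submodule.add_mem _ hx hy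
    | tmul x y => exact Submodule.subset_span ⟨(HopfAlgebra.antipode k x, y • r), rfl⟩

/-- The Frobenius system of `R → R # H` given by a Frobenius form on `H`. -/
noncomputable def frobeniusSystem {l : H →ₗ[k] k} {n : ℕ} {x y : Fin n → H}
    (hl : ∀ h : H, TensorProduct.rid k H (l.lTensor H (Coalgebra.comul h)) = l h • 1)
    (hx : ∀ h : H, ∑ i, l (y i * h) • x i = h) (hy : ∀ h : H, ∑ i, l (h * x i) • y i = h) :
    FrobeniusSystem (incl k H R : R →+* SmashProduct k H R) where
  size := n
  form := (formMap l).toAddMonoidHom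
  x i := inclHopf k H R (x i)
  y i := inclHopf k H R (y i)
  form_left := formMap_incl_mul l
  form_right := formMap_mul_incl hl
  sum_right b := by
    change ∑ i, inclHopf k H R (x i) * incl k H R (formMap l (inclHopf k H R (y i) * b)) = b
    -- The form is right `R`-linear, so on products `h r` the identity reduces to the dual basis
    -- expansion of `h` in `H`. For `sum_left`, left linearity and products `r h` play the same
    -- role.
    induction mem_span_inclHopf_mul_incl b using Submodule.span_induction with
    | zero => simp
    | add a b _ _ h1 h2 => simp only [mul_add, map_add, Finset.sum_add_distrib, h1, h2]
    | smul c b _ h => simp only [mul_smul_comm, map_smul, ← Finset.smul_sum, h]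
    | mem b hb =>
      obtain ⟨⟨h, r⟩, rfl⟩ := hb
      simp only [← mul_assoc, formMap_mul_incl hl, ← map_mul]
      simp only [inclHopf_apply (R := R) (y _ * h), formMap_mk, map_mul, map_smul, map_one,
        mul_smul_comm, mul_one, ← mul_assoc]
      rw [← Finset.sum_mul]
      simp only [← map_smul, ← map_sum, hx]
  sum_left b := by
    change ∑ i, incl k H R (formMap l (b * inclHopf k H R (x i))) * inclHopf k H R (y i) = b
    induction b using SmashProduct.induction with
    | hz => simp
    | ha a b h1 h2 => simp only [add_mul, map_add, Finset.sum_add_distrib, h1, h2]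
    | hm r h =>
      simp only [← incl_mul_inclHopf, mul_assoc, formMap_incl_mul, ← map_mul]
      simp only [inclHopf_apply (R := R) (h * x _), formMap_mk, map_mul, map_smul, map_one,
        smul_mul_assoc, one_mul, mul_assoc]
      rw [← Finset.mul_sum]
      simp only [← map_smul, ← map_sum, hy]

end SmashProduct

/-! ### Dimension shifting for `Ext` -/

section DimensionShifting

open Abelian

variable {C : Type*} [Category C] [Abelian C] [HasExt C] {S : ShortComplex C}

theorem subsingleton_ext_zero_iff {X Y : C} :
    Subsingleton (Ext X Y 0) ↔ ∀ f : X ⟶ Y, f = 0 := by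
  rw [Ext.homEquiv₀.subsingleton_congr]
  exact ⟨fun _ f => Subsingleton.elim _ _, fun h => ⟨fun f g => (h f).trans (h g).symm⟩⟩

/-- `Ext¹(X₃, Y)` is the cokernel of `Hom(X₂, Y) → Hom(X₁, Y)` when `X₂` is projective. Stated as an
extension property, its vanishing can be transported along natural bijections of `Hom` sets. -/
theorem subsingleton_ext_one_iff (hS : S.ShortExact) [Projective S.X₂] (Y : C) :
    Subsingleton (Ext S.X₃ Y 1) ↔ ∀ f : S.X₁ ⟶ Y, ∃ g : S.X₂ ⟶ Y, S.f ≫ g = f := by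
  constructor
  · intro h f
    obtain ⟨x, hx⟩ := Ext.contravariant_sequence_exact₁ hS Y (Ext.mk₀ f) (add_zero 1)
      (Subsingleton.elim _ _)
    obtain ⟨g, rfl⟩ := Ext.homEquiv₀.symm.surjective x
    refine ⟨g, (Ext.mk₀_bijective _ _).1 ?_⟩
    rw [← hx, ← Ext.mk₀_comp_mk₀]
    rfl
  · intro h
    refine subsingleton_of_forall_eq 0 fun x => ?_
    obtain ⟨y, rfl⟩ := Ext.contravariant_sequence_exact₃ hS Y x (Ext.eq_zero_of_projective _)
      (add_zero 1)
    obtain ⟨f, rfl⟩ := (Ext.mk₀_bijective _ _).2 y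
    obtain ⟨g, rfl⟩ := h f
    rw [← Ext.mk₀_comp_mk₀, ShortComplex.ShortExact.extClass_comp_assoc]

/-- In the long exact sequence, the terms for `X₂` in degrees `n + 1` and `n + 2` are both zero. -/
theorem subsingleton_ext_add_two_iff (hS : S.ShortExact) [Projective S.X₂] (Y : C) (n : ℕ) :
    Subsingleton (Ext S.X₃ Y (n + 2)) ↔ Subsingleton (Ext S.X₁ Y (n + 1)) := by
  have h1 : 1 + (n + 1) = n + 2 := by omega
  constructor
  · intro h
    refine subsingleton_of_forall_eq 0 fun x => ?_
    obtain ⟨y, rfl⟩ := Ext.contravariant_sequence_exact₁ hS Y x h1 (Subsingleton.elim _ _)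
    rw [Ext.eq_zero_of_projective y, Ext.comp_zero]
  · intro h
    refine subsingleton_of_forall_eq 0 fun x => ?_
    obtain ⟨y, rfl⟩ := Ext.contravariant_sequence_exact₃ hS Y x (Ext.eq_zero_of_projective _) h1
    rw [Subsingleton.elim y 0, Ext.comp_zero]

end DimensionShifting

/-! ### `Ext` and finiteness along a Frobenius extension -/

namespace FrobeniusSystem

variable {R B : Type u} [Ring R] [Ring B] {φ : R →+* B} (F : FrobeniusSystem φ)
include F

/-- Composition with the Frobenius homomorphism. -/
noncomputable def push {M : ModuleCat.{u} Bᵐᵒᵖ} (f : M ⟶ ModuleCat.of Bᵐᵒᵖ B) :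
    (ModuleCat.restrictScalars φ.op).obj M ⟶ ModuleCat.of Rᵐᵒᵖ R :=
  ModuleCat.ofHom (X := (ModuleCat.restrictScalars φ.op).obj M) (Y := R)
    { toFun := fun m => F.form (f.hom m)
      map_add' := fun a b => (congrArg F.form (map_add f.hom a b)).trans (map_add F.form _ _)
      map_smul' := fun r m => (congrArg F.form
        (map_smul f.hom (MulOpposite.op (φ r.unop)) m)).trans (F.form_right r.unop _) }

/-- `f` is recovered from `E ∘ f`: `f(m) = ∑ φ(E(f(m) xᵢ)) yᵢ`, and `f(m) xᵢ = f(m xᵢ)`. -/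
theorem push_injective {M : ModuleCat.{u} Bᵐᵒᵖ} :
    Function.Injective (F.push (M := M)) := by
  intro f g h
  ext m
  have key (b : B) : ∀ f : M ⟶ ModuleCat.of Bᵐᵒᵖ B, F.form (f.hom m * b) =
      (F.push f).hom (MulOpposite.op b • m : M) :=
    fun f => congrArg F.form (map_smul f.hom (MulOpposite.op b) m).symm
  change (f.hom m : B) = g.hom m
  rw [← F.sum_left (f.hom m : B), ← F.sum_left (g.hom m : B)]
  simp only [key, h]

/-- The recovery formula dictates the preimage of `g`, namely `f(m) = ∑ φ(g(m xᵢ)) yᵢ`. -/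
theorem push_surjective {M : ModuleCat.{u} Bᵐᵒᵖ} :
    Function.Surjective (F.push (M := M)) := by
  intro g
  let γ : M → R := fun m => g.hom m
  have hadd (a b : M) : γ (a + b) = γ a + γ b := map_add g.hom a b
  have hlin (r : R) (m : (ModuleCat.restrictScalars φ.op).obj M) :
      g.hom (MulOpposite.op r • m) = MulOpposite.op r • g.hom m := map_smul g.hom _ m
  have hsmul (r : R) (m : M) : γ (MulOpposite.op (φ r) • m) = γ m * r :=
    hlin r m
  let γ' : M →+ R := AddMonoidHom.mk' γ hadd
  let f : M → B := fun m => ∑ i, φ (γ (MulOpposite.op (F.x i) • m)) * F.y i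
  have hf (b : B) (m : M) : f (MulOpposite.op b • m) = f m * b := by
    -- Expansion of `b xᵢ` as `∑ xⱼ φ(E(yⱼ b xᵢ))`; summing over `i` first then reassembles `yⱼ b`
    -- by `sum_left`.
    have h1 (i) : γ (MulOpposite.op (F.x i) • MulOpposite.op b • m) =
        ∑ j, γ (MulOpposite.op (F.x j) • m) * F.form (F.y j * b * F.x i) := by
      simp only [← hsmul]
      change _ = ∑ j, γ' _
      rw [← map_sum]
      change _ = γ _
      congr 1
      simp only [smul_smul, ← MulOpposite.op_mul, ← Finset.sum_smul, ← Finset.op_sum]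
      simp only [mul_assoc, F.sum_right]
    simp only [f, h1, map_sum, map_mul, Finset.sum_mul, mul_assoc]
    rw [Finset.sum_comm]
    refine Finset.sum_congr rfl fun j _ => ?_
    rw [← Finset.mul_sum]
    congr 1
    simpa only [mul_assoc] using F.sum_left (F.y j * b)
  refine ⟨ModuleCat.ofHom (X := M) (Y := B)
    { toFun := f
      map_add' := fun a b => by
        simp only [f, smul_add, hadd, map_add, add_mul, Finset.sum_add_distrib]
      map_smul' := fun b m => hf b.unop m }, ?_⟩
  refine ModuleCat.hom_ext (LinearMap.ext fun (m : M) => ?_)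
  change F.form (∑ i, φ (γ (MulOpposite.op (F.x i) • m)) * F.y i) = γ m
  rw [map_sum]
  have h2 (i) : F.form (φ (γ (MulOpposite.op (F.x i) • m)) * F.y i) =
      γ (MulOpposite.op (φ (F.form (F.y i))) • MulOpposite.op (F.x i) • m) :=
    (F.form_left _ _).trans (hsmul _ _).symm
  simp only [h2]
  change ∑ i, γ' (MulOpposite.op (φ (F.form (F.y i))) • MulOpposite.op (F.x i) • m) = γ m
  rw [← map_sum]
  change γ _ = γ m
  congr 1
  -- `E(f(m)) = ∑ g(m xᵢ) E(yᵢ) = g(m ∑ xᵢ φ(E(yᵢ)))`, and the last sum is the expansion of `1`.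
  have h1 := F.sum_right 1
  simp only [mul_one] at h1
  simp only [smul_smul, ← MulOpposite.op_mul, ← Finset.sum_smul, ← Finset.op_sum, h1,
    MulOpposite.op_one, one_smul]

/-- The coordinates `b ↦ E(yⱼ b)` and the generators `xⱼ` split `B` off a finite free right
`R`-module, and a projective `B`-module is a summand of a free one. -/
theorem projective_restrictScalars (P : ModuleCat.{u} Bᵐᵒᵖ) [Projective P] :
    Projective ((ModuleCat.restrictScalars φ.op).obj P) := by
  have hP : Module.Projective Bᵐᵒᵖ P := inferInstance
  obtain ⟨s, hs⟩ := Module.projective_def.1 hP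
  let N := (ModuleCat.restrictScalars φ.op).obj P
  let : Module Rᵐᵒᵖ Bᵐᵒᵖ := Module.compHom Bᵐᵒᵖ φ.op
  have hB : Module.Projective Rᵐᵒᵖ Bᵐᵒᵖ := by
    let i : Bᵐᵒᵖ →ₗ[Rᵐᵒᵖ] (Fin F.size → Rᵐᵒᵖ) :=
      { toFun := fun b j => MulOpposite.op (F.form (F.y j * b.unop))
        map_add' := fun a b => by ext j; simp [mul_add]
        map_smul' := fun r b => by
          ext j
          change MulOpposite.op (F.form (F.y j * (b.unop * φ r.unop))) = _
          rw [← mul_assoc, F.form_right]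
          rfl }
    let π : (Fin F.size → Rᵐᵒᵖ) →ₗ[Rᵐᵒᵖ] Bᵐᵒᵖ :=
      Fintype.linearCombination Rᵐᵒᵖ fun j => MulOpposite.op (F.x j)
    refine Module.Projective.of_split i π (LinearMap.ext fun b => ?_)
    have h1 := congrArg MulOpposite.op (F.sum_right b.unop)
    rw [Finset.op_sum] at h1
    exact h1
  let i : N →ₗ[Rᵐᵒᵖ] (P →₀ Bᵐᵒᵖ) :=
    { toFun := s
      map_add' := fun p q => map_add s p q
      map_smul' := fun r p => map_smul s (φ.op r) p }
  let π : (P →₀ Bᵐᵒᵖ) →ₗ[Rᵐᵒᵖ] N :=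
    { toFun := Finsupp.linearCombination Bᵐᵒᵖ id
      map_add' := fun p q => map_add (Finsupp.linearCombination Bᵐᵒᵖ id) p q
      map_smul' := fun r p => map_smul (Finsupp.linearCombination Bᵐᵒᵖ id) (φ.op r) p }
  classical
  have : Module.Projective Rᵐᵒᵖ (P →₀ Bᵐᵒᵖ) :=
    Module.Projective.of_equiv (finsuppLEquivDirectSum Rᵐᵒᵖ Bᵐᵒᵖ P).symm
  have : Module.Projective Rᵐᵒᵖ N := Module.Projective.of_split i π (LinearMap.ext hs)
  exact (IsProjective.iff_projective (R := Rᵐᵒᵖ) N).1 this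

/-- Only vanishing has to be compared, so no isomorphism of `Ext` groups is built: induction on the
degree, along a projective presentation of `M` that stays one after restriction. -/
theorem subsingleton_ext_iff (M : ModuleCat.{u} Bᵐᵒᵖ) (n : ℕ) :
    Subsingleton (Abelian.Ext M (ModuleCat.of Bᵐᵒᵖ B) n) ↔
      Subsingleton (Abelian.Ext ((ModuleCat.restrictScalars φ.op).obj M)
        (ModuleCat.of Rᵐᵒᵖ R) n) := by
  have h0 (M : ModuleCat.{u} Bᵐᵒᵖ) : Function.Bijective (F.push (M := M)) :=
    ⟨F.push_injective, F.push_surjective⟩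
  have hres {S : ShortComplex (ModuleCat.{u} Bᵐᵒᵖ)} (hS : S.ShortExact) :
      (S.map (ModuleCat.restrictScalars φ.op)).ShortExact := by
    have := hS.mono_f
    have := hS.epi_g
    exact
      { exact := (ShortComplex.ShortExact.moduleCat_exact_iff_function_exact _).2
          ((ShortComplex.ShortExact.moduleCat_exact_iff_function_exact S).1 hS.exact)
        mono_f := (ModuleCat.mono_iff_injective _).2
          ((ModuleCat.mono_iff_injective S.f).1 inferInstance)
        epi_g := (ModuleCat.epi_iff_surjective _).2
          ((ModuleCat.epi_iff_surjective S.g).1 inferInstance) }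
  have hM (M : ModuleCat.{u} Bᵐᵒᵖ) := M.shortExact_projectiveShortComplex
  have hp (M : ModuleCat.{u} Bᵐᵒᵖ) : Projective M.projectiveShortComplex.X₂ :=
    (IsProjective.iff_projective (R := Bᵐᵒᵖ) _).1 inferInstance
  have hp' (M : ModuleCat.{u} Bᵐᵒᵖ) : Projective
      (M.projectiveShortComplex.map (ModuleCat.restrictScalars φ.op)).X₂ :=
    F.projective_restrictScalars _
  induction n generalizing M with
  | zero =>
    have hz : F.push (0 : M ⟶ ModuleCat.of Bᵐᵒᵖ B) = 0 := by
      ext m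
      exact map_zero F.form
    rw [subsingleton_ext_zero_iff, subsingleton_ext_zero_iff]
    refine ⟨fun h g => ?_, fun h f => (h0 M).1 ((h _).trans hz.symm)⟩
    obtain ⟨f, rfl⟩ := (h0 M).2 g
    rw [h f, hz]
  | succ n ih =>
    rcases n with _ | n
    -- Degree one is separate because `Hom(X₂, Y)` need not vanish; it uses the bijections `push` on
    -- both `X₁` and `X₂`, whose compatibility with precomposition is definitional.
    · refine (subsingleton_ext_one_iff (hM M) _).trans
        (Iff.trans ?_ (subsingleton_ext_one_iff (hres (hM M)) _).symm)
      constructor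
      · intro h f
        obtain ⟨f, rfl⟩ := (h0 _).2 f
        obtain ⟨g, rfl⟩ := h f
        exact ⟨F.push g, rfl⟩
      · intro h f
        obtain ⟨g, hg⟩ := h (F.push f)
        obtain ⟨g, rfl⟩ := (h0 _).2 g
        exact ⟨g, (h0 _).1 hg⟩
    · exact (subsingleton_ext_add_two_iff (hM M) _ _).trans ((ih _).trans
        (subsingleton_ext_add_two_iff (hres (hM M)) _ _).symm)

theorem finite_compHom_op :
    letI : Module Rᵐᵒᵖ Bᵐᵒᵖ := Module.compHom Bᵐᵒᵖ φ.op
    Module.Finite Rᵐᵒᵖ Bᵐᵒᵖ := by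
  classical
  let : Module Rᵐᵒᵖ Bᵐᵒᵖ := Module.compHom Bᵐᵒᵖ φ.op
  refine ⟨⟨Finset.univ.image fun i => MulOpposite.op (F.x i), ?_⟩⟩
  rw [eq_top_iff]
  rintro b -
  rw [← MulOpposite.op_unop b, ← F.sum_right b.unop, Finset.op_sum]
  refine Submodule.sum_mem _ fun i _ => ?_
  rw [MulOpposite.op_mul]
  exact Submodule.smul_mem _ (MulOpposite.op (F.form (F.y i * b.unop)))
    (Submodule.subset_span (by simp))

theorem isNoetherianRing_op [IsNoetherianRing Rᵐᵒᵖ] : IsNoetherianRing Bᵐᵒᵖ := by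
  let : Module Rᵐᵒᵖ Bᵐᵒᵖ := Module.compHom Bᵐᵒᵖ φ.op
  have : IsScalarTower Rᵐᵒᵖ Bᵐᵒᵖ Bᵐᵒᵖ := ⟨fun a b c => mul_assoc (φ.op a) b c⟩
  have : Module.Finite Rᵐᵒᵖ Bᵐᵒᵖ := F.finite_compHom_op
  exact isNoetherian_of_tower Rᵐᵒᵖ inferInstance

theorem finite_restrictScalars (M : ModuleCat.{u} Bᵐᵒᵖ) [Module.Finite Bᵐᵒᵖ M] :
    Module.Finite Rᵐᵒᵖ ((ModuleCat.restrictScalars φ.op).obj M) := by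
  let : Module Rᵐᵒᵖ Bᵐᵒᵖ := Module.compHom Bᵐᵒᵖ φ.op
  have : Module.Finite Rᵐᵒᵖ Bᵐᵒᵖ := F.finite_compHom_op
  let : Module Rᵐᵒᵖ M := Module.compHom M φ.op
  have : IsScalarTower Rᵐᵒᵖ Bᵐᵒᵖ M := ⟨fun a b c => mul_smul (φ.op a) b c⟩
  have h : Module.Finite Rᵐᵒᵖ M := Module.Finite.trans Bᵐᵒᵖ M
  exact h

theorem moduleGrade_restrictScalars (M : ModuleCat.{u} Bᵐᵒᵖ) :
    moduleGrade M = moduleGrade ((ModuleCat.restrictScalars φ.op).obj M) := by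
  simp only [moduleGrade, ← not_subsingleton_iff_nontrivial, F.subsingleton_ext_iff]

end FrobeniusSystem

/-! ### Graded modules and exact dimension functions -/

namespace GrMod

variable {k A : Type u} [Field k] [Ring A] [Algebra k A] {𝓐 : ℕ → Submodule k A}

/-- The zero graded module. -/
noncomputable def zero : GrMod 𝓐 where
  toMod := ModuleCat.of Aᵐᵒᵖ PUnit
  component _ := ⊥
  isInternal := by
    constructor
    · intro x y _
      refine DFinsupp.ext fun i => Subsingleton.elim _ _
    · exact fun y => ⟨DirectSum.of _ 0 0, Subsingleton.elim (α := PUnit) _ _⟩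
  smul_mem _ _ _ _ _ _ := Subsingleton.elim (α := PUnit) _ _

/-- The kernel of a degree-preserving homomorphism of graded modules. -/
noncomputable def ker {M Q : GrMod 𝓐} (g : M.toMod →ₗ[Aᵐᵒᵖ] Q.toMod) (hg : PreservesDegree g) :
    GrMod 𝓐 where
  toMod := ModuleCat.of Aᵐᵒᵖ (LinearMap.ker g)
  component i := (M.component i).comap (LinearMap.ker g).subtype.toAddMonoidHom
  isInternal := by
    classical
    let K : ℤ → AddSubgroup (LinearMap.ker g) :=
      fun i => (M.component i).comap (LinearMap.ker g).subtype.toAddMonoidHom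
    change DirectSum.IsInternal K
    constructor
    · let ι (i : ℤ) : K i →+ M.component i :=
        ((LinearMap.ker g).subtype.toAddMonoidHom.comp (K i).subtype).codRestrict
          (M.component i) fun x => x.2
      have hι : Function.Injective (DirectSum.map ι) :=
        (DirectSum.map_injective ι).2 fun i x y h => Subtype.ext (Subtype.ext (congrArg (·.1) h))
      have hc : (DirectSum.coeAddMonoidHom M.component).comp (DirectSum.map ι) =
          (LinearMap.ker g).subtype.toAddMonoidHom.comp (DirectSum.coeAddMonoidHom K) := by
        refine DirectSum.addHom_ext fun i x => ?_
        simp only [AddMonoidHom.comp_apply, DirectSum.map_of, DirectSum.coeAddMonoidHom_of]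
        rfl
      intro x y h
      refine hι (M.isInternal.1 ?_)
      have hx := DFunLike.congr_fun hc x
      have hy := DFunLike.congr_fun hc y
      simp only [AddMonoidHom.comp_apply] at hx hy
      rw [hx, hy, h]
    · rintro ⟨m, hm⟩
      obtain ⟨x, rfl⟩ := M.isInternal.2 m
      let γ (i : ℤ) : M.component i →+ Q.component i :=
        (g.toAddMonoidHom.comp (M.component i).subtype).codRestrict (Q.component i)
          fun x => hg i _ x.2
      have hc : (DirectSum.coeAddMonoidHom Q.component).comp (DirectSum.map γ) =
          g.toAddMonoidHom.comp (DirectSum.coeAddMonoidHom M.component) := by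
        refine DirectSum.addHom_ext fun i x => ?_
        simp only [AddMonoidHom.comp_apply, DirectSum.map_of, DirectSum.coeAddMonoidHom_of]
        rfl
      -- The homogeneous components of a kernel element lie in the kernel: their images are the
      -- components of `g m = 0`, and the decomposition in `Q` is unique.
      have hx : DirectSum.map γ x = 0 := by
        refine Q.isInternal.1 ?_
        rw [map_zero]
        exact (DFunLike.congr_fun hc x).trans hm
      have hz (i : ℤ) : g (x i) = 0 := by
        have := congrArg (fun z => ((z i : Q.component i) : Q.toMod)) hx
        simp only [DirectSum.map_apply] at this
        exact this
      refine ⟨∑ i ∈ DFinsupp.support x, DirectSum.of (fun i => K i) i ⟨⟨x i, hz i⟩, (x i).2⟩,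
        Subtype.ext ?_⟩
      rw [map_sum]
      simp only [DirectSum.coeAddMonoidHom_of, AddSubmonoidClass.coe_finsetSum]
      conv_rhs => rw [← DirectSum.sum_support_of x, map_sum]
      simp only [DirectSum.coeAddMonoidHom_of]
  smul_mem i n m a hm ha := M.smul_mem i n m.1 a hm ha

/-- The direct sum of two graded modules. -/
noncomputable def prod (M N : GrMod 𝓐) : GrMod 𝓐 where
  toMod := ModuleCat.of Aᵐᵒᵖ (M.toMod × N.toMod)
  component i := (M.component i).prod (N.component i)
  isInternal := by
    classical
    let P : ℤ → AddSubgroup (M.toMod × N.toMod) :=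
      fun i => (M.component i).prod (N.component i)
    change DirectSum.IsInternal P
    constructor
    · let p (i : ℤ) : P i →+ M.component i :=
        ((AddMonoidHom.fst _ _).comp (P i).subtype).codRestrict (M.component i) fun x => x.2.1
      let q (i : ℤ) : P i →+ N.component i :=
        ((AddMonoidHom.snd _ _).comp (P i).subtype).codRestrict (N.component i) fun x => x.2.2
      have hp : (DirectSum.coeAddMonoidHom M.component).comp (DirectSum.map p) =
          (AddMonoidHom.fst _ _).comp (DirectSum.coeAddMonoidHom P) := by
        refine DirectSum.addHom_ext fun i x => ?_
        simp only [AddMonoidHom.comp_apply, DirectSum.map_of, DirectSum.coeAddMonoidHom_of]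
        rfl
      have hq : (DirectSum.coeAddMonoidHom N.component).comp (DirectSum.map q) =
          (AddMonoidHom.snd _ _).comp (DirectSum.coeAddMonoidHom P) := by
        refine DirectSum.addHom_ext fun i x => ?_
        simp only [AddMonoidHom.comp_apply, DirectSum.map_of, DirectSum.coeAddMonoidHom_of]
        rfl
      intro x y h
      have h1 : DirectSum.map p x = DirectSum.map p y := by
        refine M.isInternal.1 ?_
        have hx := DFunLike.congr_fun hp x
        have hy := DFunLike.congr_fun hp y
        simp only [AddMonoidHom.comp_apply] at hx hy
        rw [hx, hy, h]
      have h2 : DirectSum.map q x = DirectSum.map q y := by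
        refine N.isInternal.1 ?_
        have hx := DFunLike.congr_fun hq x
        have hy := DFunLike.congr_fun hq y
        simp only [AddMonoidHom.comp_apply] at hx hy
        rw [hx, hy, h]
      refine DFinsupp.ext fun i => Subtype.ext (Prod.ext ?_ ?_)
      · have := congrArg (fun z => ((z i : M.component i) : M.toMod)) h1
        simp only [DirectSum.map_apply] at this
        exact this
      · have := congrArg (fun z => ((z i : N.component i) : N.toMod)) h2
        simp only [DirectSum.map_apply] at this
        exact this
    · let p (i : ℤ) : M.component i →+ P i :=
        ((AddMonoidHom.inl _ _).comp (M.component i).subtype).codRestrict (P i)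
          fun x => ⟨x.2, (N.component i).zero_mem⟩
      let q (i : ℤ) : N.component i →+ P i :=
        ((AddMonoidHom.inr _ _).comp (N.component i).subtype).codRestrict (P i)
          fun x => ⟨(M.component i).zero_mem, x.2⟩
      have hp : (DirectSum.coeAddMonoidHom P).comp (DirectSum.map p) =
          (AddMonoidHom.inl _ _).comp (DirectSum.coeAddMonoidHom M.component) := by
        refine DirectSum.addHom_ext fun i x => ?_
        simp only [AddMonoidHom.comp_apply, DirectSum.map_of, DirectSum.coeAddMonoidHom_of]
        rfl
      have hq : (DirectSum.coeAddMonoidHom P).comp (DirectSum.map q) =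
          (AddMonoidHom.inr _ _).comp (DirectSum.coeAddMonoidHom N.component) := by
        refine DirectSum.addHom_ext fun i x => ?_
        simp only [AddMonoidHom.comp_apply, DirectSum.map_of, DirectSum.coeAddMonoidHom_of]
        rfl
      rintro ⟨m, n⟩
      obtain ⟨x, rfl⟩ := M.isInternal.2 m
      obtain ⟨y, rfl⟩ := N.isInternal.2 n
      refine ⟨DirectSum.map p x + DirectSum.map q y, ?_⟩
      have hx := DFunLike.congr_fun hp x
      have hy := DFunLike.congr_fun hq y
      simp only [AddMonoidHom.comp_apply] at hx hy
      rw [map_add, hx, hy]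
      simp
  smul_mem i n m a hm ha := ⟨M.smul_mem i n m.1 a hm.1 ha, N.smul_mem i n m.2 a hm.2 ha⟩

/-- Noetherianity makes the kernel finitely generated, as exactness of `∂` requires. -/
theorem dim_le_of_surjective [IsNoetherianRing Aᵐᵒᵖ] {dim : GrMod 𝓐 → EReal}
    (hdim : IsExactDimension dim) {M Q : GrMod 𝓐} (hM : M.FG)
    (g : M.toMod →ₗ[Aᵐᵒᵖ] Q.toMod) (hg : PreservesDegree g) (hs : Function.Surjective g) :
    dim Q ≤ dim M := by
  have : Module.Finite Aᵐᵒᵖ M.toMod := hM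
  have hQ : Q.FG := Module.Finite.of_surjective g hs
  have hK : (ker g hg).FG := inferInstanceAs (Module.Finite Aᵐᵒᵖ (LinearMap.ker g))
  rw [hdim (ker g hg) M Q (LinearMap.ker g).subtype g hK hM hQ (fun _ _ h => h) hg
    Subtype.val_injective (LinearMap.exact_subtype_ker_map g) hs]
  exact le_max_right _ _

theorem dim_prod {dim : GrMod 𝓐 → EReal} (hdim : IsExactDimension dim) {M N : GrMod 𝓐}
    (hM : M.FG) (hN : N.FG) : dim (M.prod N) = max (dim M) (dim N) := by
  have : Module.Finite Aᵐᵒᵖ M.toMod := hM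
  have : Module.Finite Aᵐᵒᵖ N.toMod := hN
  have hP : (M.prod N).FG := inferInstanceAs (Module.Finite Aᵐᵒᵖ (M.toMod × N.toMod))
  exact hdim M (M.prod N) N (LinearMap.inl Aᵐᵒᵖ M.toMod N.toMod)
    (LinearMap.snd Aᵐᵒᵖ M.toMod N.toMod) hM hP hN
    (fun i m hm => ⟨hm, (N.component i).zero_mem⟩) (fun i m hm => hm.2)
    LinearMap.inl_injective Function.Exact.inl_snd LinearMap.snd_surjective

variable [GradedAlgebra 𝓐]

theorem regular_fg : (regular 𝓐).FG := by
  have h (a : A) : ∃ c, LinearMap.toSpanSingleton Aᵐᵒᵖ A 1 c = a :=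
    ⟨MulOpposite.op a, one_mul a⟩
  exact Module.Finite.of_surjective (LinearMap.toSpanSingleton Aᵐᵒᵖ A 1) h

/-- There is a graded module of dimension at most `∂(A)` which maps onto all graded modules
generated by `n` elements of degree zero. -/
theorem exists_free [IsNoetherianRing Aᵐᵒᵖ] {dim : GrMod 𝓐 → EReal}
    (hdim : IsExactDimension dim) (n : ℕ) :
    ∃ P : GrMod 𝓐, P.FG ∧ dim P ≤ dim (regular 𝓐) ∧
      ∀ (N : GrMod 𝓐) (b : Fin n → N.toMod), (∀ i, b i ∈ N.component 0) →
        ∃ f : P.toMod →ₗ[Aᵐᵒᵖ] N.toMod, PreservesDegree f ∧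
          LinearMap.range f = Submodule.span Aᵐᵒᵖ (Set.range b) := by
  induction n with
  | zero =>
    -- No value of `∂` on the zero module is prescribed; the bound holds because zero is a quotient
    -- of the regular module.
    refine ⟨zero, inferInstanceAs (Module.Finite Aᵐᵒᵖ PUnit.{u + 1}),
      dim_le_of_surjective hdim regular_fg (0 : (regular 𝓐).toMod →ₗ[Aᵐᵒᵖ] PUnit.{u + 1})
        (fun _ _ _ => Subsingleton.elim (α := PUnit) _ _)
        (fun y => ⟨0, Subsingleton.elim (α := PUnit) _ _⟩),
      fun N b _ => ⟨0, fun i _ _ => (N.component i).zero_mem, ?_⟩⟩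
    rw [Set.range_eq_empty, Submodule.span_empty, LinearMap.range_zero]
  | succ n ih =>
    obtain ⟨P, hP, hle, h⟩ := ih
    have h1 : Module.Finite Aᵐᵒᵖ P.toMod := hP
    have h2 : Module.Finite Aᵐᵒᵖ (regular 𝓐).toMod := regular_fg
    refine ⟨(regular 𝓐).prod P,
      inferInstanceAs (Module.Finite Aᵐᵒᵖ ((regular 𝓐).toMod × P.toMod)),
      (dim_prod hdim regular_fg hP).trans_le (max_le le_rfl hle), fun N b hb => ?_⟩
    obtain ⟨f, hf, hr⟩ := h N (Fin.tail b) fun i => hb i.succ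
    let g : A →ₗ[Aᵐᵒᵖ] N.toMod :=
      { toFun := fun a => MulOpposite.op a • b 0
        map_add' := fun a c => add_smul (MulOpposite.op a) (MulOpposite.op c) (b 0)
        map_smul' := fun a c => mul_smul a (MulOpposite.op c) (b 0) }
    have hg : PreservesDegree (M := regular 𝓐) g := by
      rintro (i | i) (a : A) ha
      · have := N.smul_mem 0 i (b 0) a (hb 0) ha
        rwa [zero_add] at this
      · have h0 : a = 0 := ha
        have h1 : g a = 0 := by rw [h0, map_zero]
        change g a ∈ _
        rw [h1]
        exact AddSubgroup.zero_mem _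
    refine ⟨(show (regular 𝓐).toMod →ₗ[Aᵐᵒᵖ] N.toMod from g).coprod f, fun i m hm => AddSubgroup.add_mem _ (hg i _ hm.1) (hf i _ hm.2), ?_⟩
    rw [← Fin.cons_self_tail b, Fin.range_cons, Submodule.span_insert, ← hr]
    refine (LinearMap.range_coprod g f).trans (congrArg (· ⊔ LinearMap.range f) ?_)
    refine le_antisymm ?_ ?_
    · rintro _ ⟨a, rfl⟩
      exact Submodule.mem_span_singleton.2 ⟨MulOpposite.op (a : A), rfl⟩
    · rw [Submodule.span_singleton_le_iff_mem]
      exact ⟨(1 : A), one_smul Aᵐᵒᵖ (b 0)⟩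

/-- `∂` is not assumed invariant under degree shifts. Generators of degree zero avoid shifts, since
`N` is then a graded quotient of a sum of unshifted copies of `A`. -/
theorem dim_le_regular [IsNoetherianRing Aᵐᵒᵖ] {dim : GrMod 𝓐 → EReal}
    (hdim : IsExactDimension dim) {N : GrMod 𝓐} {n : ℕ} (b : Fin n → N.toMod)
    (hb : ∀ i, b i ∈ N.component 0) (hs : Submodule.span Aᵐᵒᵖ (Set.range b) = ⊤) :
    dim N ≤ dim (regular 𝓐) := by
  obtain ⟨P, hP, hle, h⟩ := exists_free hdim n
  obtain ⟨f, hf, hr⟩ := h N b hb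
  exact (dim_le_of_surjective hdim hP f hf (LinearMap.range_eq_top.1 (hr.trans hs))).trans hle

end GrMod

/-! ### Noetherianity and dimension of the smash product -/

namespace SmashProduct

variable {k H R : Type u} [Field k] [Ring H] [HopfAlgebra k H] [Ring R] [Algebra k R]

theorem formMap_mem (𝓡 : ℕ → Submodule k R) (l : H →ₗ[k] k) {n : ℕ} {b : SmashProduct k H R}
    (hb : b ∈ smashGrading H 𝓡 n) : formMap l b ∈ 𝓡 n := by
  obtain ⟨z, rfl⟩ := hb
  change TensorProduct.rid k R (l.lTensor R ((𝓡 n).subtype.rTensor H z)) ∈ 𝓡 n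
  induction z using TensorProduct.induction_on with
  | zero => simp
  | add x y hx hy => simp only [map_add]; exact Submodule.add_mem _ hx hy
  | tmul r h => simpa using Submodule.smul_mem _ _ r.2

variable [Module H R] [HopfModuleAlgebra k H R]

theorem inclHopf_mem (𝓡 : ℕ → Submodule k R) [GradedAlgebra 𝓡] (h : H) :
    inclHopf k H R h ∈ smashGrading H 𝓡 0 :=
  smashGrading.tmul_mem 𝓡 SetLike.GradedOne.one_mem h

/-- A basis of `H` generates `R # H` as a left `R`-module. -/
theorem isNoetherianRing [FiniteDimensional k H] [IsNoetherianRing R] :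
    IsNoetherianRing (SmashProduct k H R) := by
  classical
  let B := SmashProduct k H R
  let : Module R B := Module.compHom B (incl k H R : R →+* B)
  have : IsScalarTower R B B := ⟨fun a b c => mul_assoc (incl k H R a) b c⟩
  let e := Module.finBasis k H
  have : Module.Finite R B := by
    refine ⟨⟨Finset.univ.image fun i => inclHopf k H R (e i), ?_⟩⟩
    rw [eq_top_iff]
    rintro b -
    induction b using SmashProduct.induction with
    | hz => exact Submodule.zero_mem _
    | ha a b h1 h2 => exact Submodule.add_mem _ h1 h2
    | hm r h =>
      have h1 : mk k H R r h = ∑ i, (e.repr h i • r) • inclHopf k H R (e i) := by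
        change _ = ∑ i, incl k H R (e.repr h i • r) * inclHopf k H R (e i)
        simp only [map_smul, smul_mul_assoc, ← mul_smul_comm]
        rw [← Finset.mul_sum]
        simp only [← map_smul, ← map_sum, e.sum_repr, incl_mul_inclHopf]
      rw [h1]
      exact Submodule.sum_mem _ fun i _ => Submodule.smul_mem _ _
        (Submodule.subset_span (by simp))
  exact isNoetherian_of_tower R inferInstance

/-- The regular module of `R # H` and that of `R` have the same dimension over `R`. -/
theorem dim_restrict_regular [IsNoetherianRing Rᵐᵒᵖ] (𝓡 : ℕ → Submodule k R) [GradedAlgebra 𝓡]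
    [ActsHomogeneously H 𝓡] {dim : GrMod 𝓡 → EReal} (hdim : IsExactDimension dim)
    [FiniteDimensional k H] [IsSemisimpleRing H] :
    dim ((GrMod.regular (smashGrading H 𝓡)).restrict (incl k H R) (incl_mem 𝓡)) =
      dim (GrMod.regular 𝓡) := by
  obtain ⟨l, n, x, y, hl, hx, hy⟩ := exists_frobenius_form k H
  let F := frobeniusSystem (R := R) hl hx hy
  let N := (GrMod.regular (smashGrading H 𝓡)).restrict (incl k H R) (incl_mem 𝓡)
  have hN : N.FG := by
    have : Module.Finite (SmashProduct k H R)ᵐᵒᵖ (GrMod.regular (smashGrading H 𝓡)).toMod :=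
      GrMod.regular_fg
    exact F.finite_restrictScalars (GrMod.regular (smashGrading H 𝓡)).toMod
  refine le_antisymm ?_ ?_
  -- Upper bound: the elements `1 # xᵢ` generate `B` as a right `R`-module and have degree zero.
  · let b (i : Fin n) : N.toMod := inclHopf k H R (x i)
    refine GrMod.dim_le_regular hdim (N := N) b (fun i => inclHopf_mem 𝓡 (x i)) ?_
    rw [eq_top_iff]
    rintro (c : SmashProduct k H R) -
    have h1 : (∑ i, MulOpposite.op (formMap l (inclHopf k H R (y i) * c)) • b i : N.toMod) = c :=
      F.sum_right c
    rw [← h1]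
    exact Submodule.sum_mem _ fun i _ => Submodule.smul_mem _ _
      (Submodule.subset_span ⟨i, rfl⟩)
  -- Lower bound: if `l(c) = 1`, then `b ↦ E((1 # c) b)` is a graded right `R`-linear map `B → R`
  -- that sends `r # 1` to `r`. Such `c` exists, as `l = 0` would make the dual basis expansion give
  -- `1 = 0` in `H`.
  · obtain ⟨c, hc⟩ : ∃ c, l c = 1 := by
      have : Nontrivial H := by
        refine ⟨0, 1, fun h => zero_ne_one (α := k) ?_⟩
        rw [← Bialgebra.counit_one (R := k) (A := H), ← h, map_zero]
      obtain ⟨c, hc⟩ : ∃ c, l c ≠ 0 := by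
        by_contra! h
        refine one_ne_zero (α := H) ?_
        rw [← hx 1]
        exact Finset.sum_eq_zero fun i _ => by rw [h, zero_smul]
      exact ⟨(l c)⁻¹ • c, by rw [map_smul, smul_eq_mul, inv_mul_cancel₀ hc]⟩
    let p : SmashProduct k H R → R := fun b => formMap l (inclHopf k H R c * b)
    have hadd (a b : SmashProduct k H R) : p (a + b) = p a + p b := by
      simp only [p, mul_add, map_add]
    have hsmul (r : R) (b : SmashProduct k H R) : p (b * incl k H R r) = p b * r := by
      simp only [p, ← mul_assoc, formMap_mul_incl hl]
    let g : N.toMod →ₗ[Rᵐᵒᵖ] (GrMod.regular 𝓡).toMod :=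
      { toFun := p
        map_add' := hadd
        map_smul' := fun r b => hsmul r.unop b }
    refine GrMod.dim_le_of_surjective hdim hN g ?_ ?_
    · rintro (i | i) (b : SmashProduct k H R) hb
      · have h1 : inclHopf k H R c * b ∈ smashGrading H 𝓡 (0 + i) :=
          SetLike.GradedMul.mul_mem (inclHopf_mem 𝓡 c) hb
        rw [zero_add] at h1
        exact formMap_mem 𝓡 l h1
      · have h0 : b = 0 := hb
        change p b = 0
        simp only [p, h0, mul_zero, map_zero]
    · intro (r : R)
      refine ⟨incl k H R r, ?_⟩
      change formMap l (inclHopf k H R c * incl k H R r) = r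
      rw [formMap_mul_incl hl, inclHopf_apply, formMap_mk, hc, one_smul, one_mul]

end SmashProduct

/-! ### Transfer of grade and Cohen-Macaulay conditions -/

theorem proposition3p3 (k H R : Type u) [Field k]
    -- `H` is a finite-dimensional semisimple Hopf algebra over the field `k`
    [Ring H] [HopfAlgebra k H] [FiniteDimensional k H] [IsSemisimpleRing H]
    -- `R` is a noetherian, locally finite, `ℕ`-graded algebra
    [Ring R] [Algebra k R] [IsNoetherianRing R] [IsNoetherianRing Rᵐᵒᵖ]
    (𝓡 : ℕ → Submodule k R) [GradedAlgebra 𝓡] (hfin : ∀ n, FiniteDimensional k (𝓡 n))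
    -- `R` is a graded left `H`-module algebra
    [Module H R] [HopfModuleAlgebra k H R] [ActsHomogeneously H 𝓡]
    -- `∂` is an exact dimension function on finitely generated graded right modules over `R`
    -- and over `B = R # H`, and it is `B/R`-hereditary
    (dimR : GrMod 𝓡 → EReal) (dimB : GrMod (smashGrading H 𝓡) → EReal)
    (hdimR : IsExactDimension dimR) (hdimB : IsExactDimension dimB)
    (hered : IsHereditary (SmashProduct.incl k H R) (incl_mem 𝓡) dimR dimB) :
    (IsCM 𝓡 dimR → IsCM (smashGrading H 𝓡) dimB) ∧
    (∀ s : ℤ, IsCMs 𝓡 dimR s → IsCMs (smashGrading H 𝓡) dimB s) ∧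
    (∀ s : ℤ, IsCMl 𝓡 dimR s → IsCMl (smashGrading H 𝓡) dimB s) ∧
    (∀ s : ℤ, IsCMr 𝓡 dimR s → IsCMr (smashGrading H 𝓡) dimB s) ∧
    (∀ M : GrMod (smashGrading H 𝓡), M.FG →
      moduleGrade M.toMod = moduleGrade (M.restrict (SmashProduct.incl k H R) (incl_mem 𝓡)).toMod) ∧
    IsNoetherianRing (SmashProduct k H R) ∧ IsNoetherianRing (SmashProduct k H R)ᵐᵒᵖ := by
  obtain ⟨l, n, x, y, hl, hx, hy⟩ := exists_frobenius_form k H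
  let F := SmashProduct.frobeniusSystem (R := R) hl hx hy
  have hgrade (M : GrMod (smashGrading H 𝓡)) : moduleGrade M.toMod =
      moduleGrade (M.restrict (SmashProduct.incl k H R) (incl_mem 𝓡)).toMod :=
    F.moduleGrade_restrictScalars M.toMod
  have hgradeE (M : GrMod (smashGrading H 𝓡)) :
      (M.restrict (SmashProduct.incl k H R) (incl_mem 𝓡)).gradeE = M.gradeE := by
    rw [GrMod.gradeE, GrMod.gradeE, hgrade]
  have hfg (M : GrMod (smashGrading H 𝓡)) (hM : M.FG) :
      (M.restrict (SmashProduct.incl k H R) (incl_mem 𝓡)).FG :=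
    have : Module.Finite (SmashProduct k H R)ᵐᵒᵖ M.toMod := hM
    F.finite_restrictScalars M.toMod
  -- The same `d` therefore serves `R` and `B`.
  have hreg : dimB (GrMod.regular (smashGrading H 𝓡)) = dimR (GrMod.regular 𝓡) :=
    (hered _ GrMod.regular_fg).symm.trans (SmashProduct.dim_restrict_regular 𝓡 hdimR)
  refine ⟨?_, ?_, ?_, ?_, fun M _ => hgrade M, SmashProduct.isNoetherianRing,
    F.isNoetherianRing_op⟩
  · rintro ⟨d, hd, h⟩
    refine ⟨d, hreg.trans hd, fun M hM hn => ?_⟩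
    rw [← hgradeE, ← hered M hM]
    -- Restriction keeps the underlying group, so nontriviality carries over unchanged.
    exact h _ (hfg M hM) hn
  all_goals
    rintro s ⟨d, hd, h⟩
    refine ⟨d, hreg.trans hd, fun M hM => ?_⟩
    rw [← hgradeE, ← hered M hM]
    exact h _ (hfg M hM)
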